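/- Let $M$ be a (connected) Riemann surface, let $e\in M$, and let $\Psi: M\setminus\{e\}\to\widehat{\mathbb C}$ be a meromorphic function with an essential singularity at $e$. Let $D(a,\rho)\subset\widehat{\mathbb C}$ denote the open disk of radius $\rho$ centred at $a$ in the spherical metric. For $a\in\widehat{\mathbb C}$ consider functions $U_a:\rho\mapsto U_a(\rho)$, $\rho>0$, such that $U_a(\rho)$ is a connected component of $\Psi^{-1}(D(a,\rho))\subset M\setminus\{e\}$ and $U_a(\rho_1)\subset U_a(\rho_2)$ whenever $\rho_1<\rho_2$. Such a $U_a$ is an *algebraic singularity* of $\Psi^{-1}$ if $\bigcap_{\rho>0}U_a(\rho)=\{z_0\}$, where $z_0$ is a critical point of $\Psi$ (a zero of $\Psi'$, or a multiple pole of $\Psi$). It is a *transcendental singularity* of $\Psi^{-1}$ if $\bigcap_{\rho>0}U_a(\rho)=\varnothing$; it is *at $e$* if moreover $e$ lies in the closure in $M$ of $U_a(\rho)$ for every $\rho>0$ (for compact $M$ this is automatic). The singularities of $\Psi^{-1}$ are the algebraic and the transcendental ones. A transcendental singularity $U_a$ is *logarithmic* if $\Psi:U_a(\rho)\to D(a,\rho)\setminus\{a\}$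 is a universal covering for some $\rho>0$. A singularity $U_a$ is *separate* if there is $\rho_1>0$ such that for every other singularity $U_b\neq U_a$ of $\Psi^{-1}$ (possibly with $b=a$) there is $\rho_2>0$ with $U_a(\rho_1)\cap U_b(\rho_2)=\varnothing$. Then a transcendental singularity $U_a$ of $\Psi^{-1}$ at $e$ is non-logarithmic if and only if it is non-separate. -/

import Mathlib

open scoped Manifold ContDiff Topology OnePoint

noncomputable section

namespace InverseSingularity

/-- The chordal distance on the Riemann sphere `ℂ ∪ {∞}` (embedded as the unit sphere of `ℝ³`). -/
def chordalDist : OnePoint ℂ → OnePoint ℂ → ℝ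
  | ∞, ∞ => 0
  | ∞, OnePoint.some w => 2 / √(1 + ‖w‖ ^ 2)
  | OnePoint.some z, ∞ => 2 / √(1 + ‖z‖ ^ 2)
  | OnePoint.some z, OnePoint.some w =>
      2 * ‖z - w‖ / (√(1 + ‖z‖ ^ 2) * √(1 + ‖w‖ ^ 2))

/-- The spherical (geodesic) distance on the Riemann sphere: a chord of length `c` subtends an
arc of length `2 arcsin (c / 2)`. -/
def sphericalDist (z w : OnePoint ℂ) : ℝ :=
  2 * Real.arcsin (chordalDist z w / 2)

/-- The open disk `D(a, ρ)` in the spherical metric. -/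
def sphericalDisk (a : OnePoint ℂ) (ρ : ℝ) : Set (OnePoint ℂ) :=
  {w | sphericalDist w a < ρ}

/-- The map `w ↦ 1 / w` from `ℂ` to the Riemann sphere, the coordinate at `∞`. -/
def recip (w : ℂ) : OnePoint ℂ :=
  open Classical in if w = 0 then ∞ else ((w⁻¹ : ℂ) : OnePoint ℂ)

section

variable {M : Type*} [TopologicalSpace M] [ChartedSpace ℂ M]

/-- `g` is a holomorphic local expression of `Ψ` at `p`, in the chart of `M` at `p` and one of
the two standard coordinates `t`, `1 / t` of the Riemann sphere. -/
def IsLocalExpr (Ψ : M → OnePoint ℂ) (p : M) (g : ℂ → ℂ) : Prop :=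
  AnalyticAt ℂ g (chartAt ℂ p p) ∧
    ((∀ᶠ q in 𝓝 p, Ψ q = (g (chartAt ℂ p q) : OnePoint ℂ)) ∨
      (∀ᶠ q in 𝓝 p, Ψ q = recip (g (chartAt ℂ p q))))

/-- `Ψ` is meromorphic at `p`, i.e. a holomorphic map to the Riemann sphere near `p`. -/
def IsMeromorphicAt (Ψ : M → OnePoint ℂ) (p : M) : Prop :=
  ∃ g : ℂ → ℂ, IsLocalExpr Ψ p g

/-- `p` is a critical point of `Ψ`: the derivative of `Ψ` vanishes at `p` when `Ψ p` is finite,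
and `p` is a multiple pole (a multiple zero of `1 / Ψ`) when `Ψ p = ∞`. -/
def IsCriticalPoint (Ψ : M → OnePoint ℂ) (p : M) : Prop :=
  ∃ g : ℂ → ℂ, IsLocalExpr Ψ p g ∧ deriv g (chartAt ℂ p p) = 0

/-- `Ψ` is meromorphic on `M ∖ {e}` and has an essential singularity at `e`: it has no limit in
the Riemann sphere at `e`. The value `Ψ e` plays no role. -/
def IsTranscendentalMeromorphic (Ψ : M → OnePoint ℂ) (e : M) : Prop :=
  (∀ p, p ≠ e → IsMeromorphicAt Ψ p) ∧
    ¬ ∃ c : OnePoint ℂ, Filter.Tendsto Ψ (𝓝[≠] e) (𝓝 c)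

end

section

variable {M : Type*} [TopologicalSpace M]

/-- The preimage of `D(a, ρ)` under `Ψ : M ∖ {e} → ℂ ∪ {∞}`. -/
def diskPreimage (Ψ : M → OnePoint ℂ) (e : M) (a : OnePoint ℂ) (ρ : ℝ) : Set M :=
  {z | z ≠ e ∧ Ψ z ∈ sphericalDisk a ρ}

/-- A function `ρ ↦ U_a(ρ)`, `ρ > 0`, that chooses in a monotone way a connected component of
`Ψ⁻¹(D(a, ρ))`. -/
@[ext]
structure Branch (Ψ : M → OnePoint ℂ) (e : M) where
  /-- The value over which the branch lies. -/
  value : OnePoint ℂ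
  /-- The neighbourhoods `U_a(ρ)`. -/
  nbhd : Set.Ioi (0 : ℝ) → Set M
  isComponent : ∀ ρ : Set.Ioi (0 : ℝ), ∃ z ∈ diskPreimage Ψ e value ρ,
    nbhd ρ = connectedComponentIn (diskPreimage Ψ e value ρ) z
  mono : Monotone nbhd

namespace Branch

variable {Ψ : M → OnePoint ℂ} {e : M}

/-- A transcendental singularity of `Ψ⁻¹`. -/
def IsTranscendental (U : Branch Ψ e) : Prop :=
  (⋂ ρ, U.nbhd ρ) = ∅

/-- An algebraic singularity of `Ψ⁻¹`. -/
def IsAlgebraic [ChartedSpace ℂ M] (U : Branch Ψ e) : Prop :=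
  ∃ z₀, (⋂ ρ, U.nbhd ρ) = {z₀} ∧ IsCriticalPoint Ψ z₀

/-- Singularities of `Ψ⁻¹`; the branches at ordinary points are not singularities. -/
def IsSingularity [ChartedSpace ℂ M] (U : Branch Ψ e) : Prop :=
  U.IsAlgebraic ∨ U.IsTranscendental

/-- The singularity `U` sits at the essential singularity `e`: all its neighbourhoods
accumulate at `e`. -/
def AccumulatesAtEssential (U : Branch Ψ e) : Prop :=
  ∀ ρ, e ∈ closure (U.nbhd ρ)

/-- A logarithmic singularity: `Ψ : U_a(ρ) → D(a, ρ) ∖ {a}` is a universal covering for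
some `ρ > 0`. -/
def IsLogarithmic (U : Branch Ψ e) : Prop :=
  U.IsTranscendental ∧
    ∃ ρ, ∃ h : Set.MapsTo Ψ (U.nbhd ρ) (sphericalDisk U.value ρ \ {U.value}),
      IsCoveringMap h.restrict ∧ SimplyConnectedSpace (U.nbhd ρ)

/-- `U` is separate: some neighbourhood `U_a(ρ₁)` is disjoint from a neighbourhood `U_b(ρ₂)` of
every other singularity `U_b`. The radius `ρ₁` does not depend on `U_b`. -/
def IsSeparate [ChartedSpace ℂ M] (U : Branch Ψ e) : Prop :=
  ∃ ρ₁, ∀ V : Branch Ψ e, V.IsSingularity → V ≠ U → ∃ ρ₂, Disjoint (U.nbhd ρ₁) (V.nbhd ρ₂)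

end Branch

end

end InverseSingularity

end

noncomputable section

namespace InverseSingularity

open Filter Set Topology unitInterval

/-! ### Charts of the Riemann sphere centred at a point -/

/-! In the coordinate of the sphere centred at `a`, a disk of radius less than `π` becomes a ball
`B` of the plane, and `exp` maps a left half-plane `H` onto `B \ {0}` as its universal covering.
Both directions compare `U_a(ρ)` with `H`.

Separate implies logarithmic. Let `U_a(ρ)` be a separating neighbourhood. A critical point in it
would carry an algebraic singularity that never leaves `U_a(ρ)` (`not_isCriticalPoint`), so `Ψ` is a
local homeomorphism there. If a path in the punctured disk lifts on `[0, t)`, the end of the lift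
defines a branch over a point `b ≠ a`; it meets `U_a(ρ)` at every radius, so it is not a
singularity, its intersection is nonempty, and the lift converges (`exists_tendsto`). Hence paths
lift, and `exp` lifts to `F : H → U_a(ρ)` (`exists_isExpLift`), which by connectedness attains every
point not over `a` (`exists_eq`). A point over `a` would have a sheet containing all points with
value near `a`, and would lie in every `U_a(ρ')`, which is excluded for a transcendental singularity
(`coordinate_ne_zero`). If `F` were not injective it would be periodic, the circles around `a` would
have compact preimages, and a punctured neighbourhood of `e` would be trapped in `U_a(ρ')` for each
small `ρ'`; then `Ψ` would tend to `a` at `e`, which is not an essential singularity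
(`tendsto_of_isCompact`). So `F` is a homeomorphism.

Logarithmic implies separate. Let `U_a(ρ)` cover the punctured disk, and let a branch `V` over `b`
meet a smaller neighbourhood of `U` at every radius. Then `b` lies in `D(a, ρ)`. If `b ≠ a`, the
covering has a section on a small disk around `b`, and `V` is the branch at an ordinary point. If `b
= a`, the part of `U_a(ρ)` over a smaller disk is connected, which forces `V = U`. -/

theorem recip_zero : recip 0 = (∞ : OnePoint ℂ) := by simp [recip]

theorem recip_of_ne_zero {w : ℂ} (hw : w ≠ 0) : recip w = ((w⁻¹ : ℂ) : OnePoint ℂ) := by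
  simp [recip, hw]

/-- The inversion `w ↦ 1 / w` of the Riemann sphere. -/
def sphereInv (x : OnePoint ℂ) : OnePoint ℂ := x.elim ((0 : ℂ) : OnePoint ℂ) recip

theorem sphereInv_infty : sphereInv (∞ : OnePoint ℂ) = ((0 : ℂ) : OnePoint ℂ) := rfl

theorem sphereInv_coe (w : ℂ) : sphereInv (w : OnePoint ℂ) = recip w := rfl

theorem sphereInv_involutive : Function.Involutive sphereInv := by
  intro x
  induction x using OnePoint.rec with
  | infty => rw [sphereInv_infty, sphereInv_coe, recip_zero]
  | coe w =>
    rw [sphereInv_coe]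
    by_cases hw : w = 0
    · rw [hw, recip_zero, sphereInv_infty]
    · rw [recip_of_ne_zero hw, sphereInv_coe, recip_of_ne_zero (inv_ne_zero hw), inv_inv]

theorem continuous_recip : Continuous recip := by
  rw [continuous_iff_continuousAt]
  intro w
  by_cases hw : w = 0
  · subst hw
    rw [continuousAt_iff_punctured_nhds, recip_zero]
    have h1 : Tendsto (fun w : ℂ => ((w⁻¹ : ℂ) : OnePoint ℂ)) (𝓝[≠] 0) (𝓝 ∞) := by
      refine OnePoint.tendsto_coe_infty.comp ?_
      rw [coclosedCompact_eq_cocompact, ← Metric.cobounded_eq_cocompact]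
      exact tendsto_inv₀_nhdsNE_zero
    refine h1.congr' ?_
    filter_upwards [self_mem_nhdsWithin] with w hw
    exact (recip_of_ne_zero hw).symm
  · have h1 : ContinuousAt (fun w : ℂ => ((w⁻¹ : ℂ) : OnePoint ℂ)) w :=
      OnePoint.continuous_coe.continuousAt.comp (continuousAt_inv₀ hw)
    refine h1.congr ?_
    filter_upwards [isOpen_ne.mem_nhds hw] with v hv
    exact (recip_of_ne_zero hv).symm

theorem continuous_sphereInv : Continuous sphereInv := by
  rw [OnePoint.continuous_iff]
  refine ⟨?_, continuous_recip⟩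
  rw [sphereInv_infty, coclosedCompact_eq_cocompact, ← Metric.cobounded_eq_cocompact]
  have h1 : Tendsto (fun w : ℂ => ((w⁻¹ : ℂ) : OnePoint ℂ)) (Bornology.cobounded ℂ)
      (𝓝 ((0 : ℂ) : OnePoint ℂ)) :=
    OnePoint.continuous_coe.continuousAt.tendsto.comp tendsto_inv₀_cobounded
  refine h1.congr' ?_
  filter_upwards [Bornology.eventually_ne_cobounded (0 : ℂ)] with w hw
  exact (recip_of_ne_zero hw).symm

/-- The inversion of the Riemann sphere as a homeomorphism. -/
def sphereInvHomeomorph : OnePoint ℂ ≃ₜ OnePoint ℂ where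
  toEquiv := sphereInv_involutive.toPerm
  continuous_toFun := continuous_sphereInv
  continuous_invFun := continuous_sphereInv

theorem isOpenEmbedding_recip : IsOpenEmbedding recip :=
  sphereInvHomeomorph.isOpenEmbedding.comp OnePoint.isOpenEmbedding_coe

/-- Since `arctan t = arcsin (t / √(1 + t²))`, stereographic modulus `t` corresponds to the angle `2
arctan t`. -/
theorem sphericalDist_eq_of_chordalDist {x a : OnePoint ℂ} {t : ℝ}
    (h : chordalDist x a = 2 * (t / √(1 + t ^ 2))) : sphericalDist x a = 2 * Real.arctan t := by
  rw [sphericalDist, h, Real.arctan_eq_arcsin]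
  congr 2
  ring

theorem sphericalDist_eq_pi {x a : OnePoint ℂ} (h : chordalDist x a = 2) :
    sphericalDist x a = Real.pi := by
  rw [sphericalDist, h]
  norm_num
  ring

/-- A rotation of the sphere moving `0` to `a`, written in the coordinate of `ℂ`. -/
def rotation (a w : ℂ) : OnePoint ℂ :=
  open Classical in
  if 1 - star a * w = 0 then ∞ else (((w + a) / (1 - star a * w) : ℂ) : OnePoint ℂ)

theorem one_add_normSq_ne_zero (a : ℂ) : 1 + a * star a ≠ 0 := by
  have : (1 + a * star a : ℂ) = ((1 + ‖a‖ ^ 2 : ℝ) : ℂ) := by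
    push_cast
    rw [← Complex.mul_conj', starRingEnd_apply]
  rw [this]
  exact_mod_cast (by positivity : (1 + ‖a‖ ^ 2 : ℝ) ≠ 0)

/-- For `a ≠ 0` the partial fraction expansion writes the Möbius map as affine after reciprocal
after affine, and affine bijections of `ℂ` extend to homeomorphisms of the sphere. -/
theorem isOpenEmbedding_rotation (a : ℂ) : IsOpenEmbedding (rotation a) := by
  by_cases ha : a = 0
  · have : rotation a = ((↑) : ℂ → OnePoint ℂ) := by
      funext w; simp [rotation, ha]
    rw [this]
    exact OnePoint.isOpenEmbedding_coe
  have hs : star a ≠ 0 := star_ne_zero.2 ha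
  have hc : (1 + a * star a) / star a ≠ 0 := div_ne_zero (one_add_normSq_ne_zero a) hs
  let A : ℂ ≃ₜ ℂ := (Homeomorph.mulLeft₀ (-star a) (neg_ne_zero.2 hs)).trans (Homeomorph.addLeft 1)
  let B : ℂ ≃ₜ ℂ := (Homeomorph.mulLeft₀ _ hc).trans (Homeomorph.addLeft (-(star a)⁻¹))
  have : rotation a = B.onePointCongr ∘ recip ∘ A := by
    funext w
    have hA : A w = 1 - star a * w := by
      change 1 + (-star a) * w = _
      ring
    simp only [Function.comp, hA, rotation]
    split_ifs with h
    · rw [h, recip_zero]; rfl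
    · rw [recip_of_ne_zero h]
      change _ = ((-(star a)⁻¹ + (1 + a * star a) / star a * (1 - star a * w)⁻¹ : ℂ) : OnePoint ℂ)
      congr 1
      generalize hd : 1 - star a * w = d at h
      field_simp
      linear_combination -hd
  rw [this]
  exact B.onePointCongr.isOpenEmbedding.comp (isOpenEmbedding_recip.comp A.isOpenEmbedding)

/-- In homogeneous coordinates the rotation is `√(1 + ‖a‖²)` times a unitary matrix, so it scales
the Hermitian norm; this is why it preserves chordal distance. -/
theorem norm_add_sq_add_norm_one_sub_sq (a w : ℂ) :
    ‖1 - star a * w‖ ^ 2 + ‖w + a‖ ^ 2 = (1 + ‖w‖ ^ 2) * (1 + ‖a‖ ^ 2) := by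
  simp only [← Complex.normSq_eq_norm_sq, Complex.normSq_apply]
  simp
  ring

theorem chordalDist_rotation (a w : ℂ) :
    chordalDist (rotation a w) a = 2 * (‖w‖ / √(1 + ‖w‖ ^ 2)) := by
  have hid := norm_add_sq_add_norm_one_sub_sq a w
  have hwa : (0 : ℝ) < 1 + ‖a‖ ^ 2 := by positivity
  have hw : (0 : ℝ) < 1 + ‖w‖ ^ 2 := by positivity
  rw [rotation]
  split_ifs with h
  · change 2 / √(1 + ‖a‖ ^ 2) = _
    have h1 : ‖a‖ * ‖w‖ = 1 := by
      have : star a * w = 1 := (sub_eq_zero.1 h).symm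
      rw [← norm_star a, ← norm_mul, this, norm_one]
    have hw0 : 0 ≤ ‖w‖ := norm_nonneg w
    have h2 : √(1 + ‖w‖ ^ 2) = ‖w‖ * √(1 + ‖a‖ ^ 2) := by
      rw [← Real.sqrt_sq hw0, ← Real.sqrt_mul (by positivity), Real.sq_sqrt (by positivity)]
      congr 1
      linear_combination (-(‖a‖ * ‖w‖) - 1) * h1
    have h3 : ‖w‖ ≠ 0 := fun h0 => by simp [h0] at h1
    rw [h2]
    field_simp
  · change 2 * ‖(w + a) / (1 - star a * w) - a‖ /
      (√(1 + ‖(w + a) / (1 - star a * w)‖ ^ 2) * √(1 + ‖a‖ ^ 2)) = _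
    have hd : 0 < ‖1 - star a * w‖ := norm_pos_iff.2 h
    have e1 : ‖(w + a) / (1 - star a * w) - a‖ = ‖w‖ * (1 + ‖a‖ ^ 2) / ‖1 - star a * w‖ := by
      have : (w + a) / (1 - star a * w) - a = w * ((1 + ‖a‖ ^ 2 : ℝ) : ℂ) / (1 - star a * w) := by
        push_cast
        rw [← Complex.mul_conj', starRingEnd_apply]
        generalize hd : 1 - star a * w = d at h
        field_simp
        linear_combination a * hd
      rw [this, norm_div, norm_mul, Complex.norm_real, Real.norm_of_nonneg hwa.le]
    have e2 : √(1 + ‖(w + a) / (1 - star a * w)‖ ^ 2) * √(1 + ‖a‖ ^ 2) =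
        √(1 + ‖w‖ ^ 2) * (1 + ‖a‖ ^ 2) / ‖1 - star a * w‖ := by
      have : 1 + ‖(w + a) / (1 - star a * w)‖ ^ 2 =
          (1 + ‖w‖ ^ 2) * (1 + ‖a‖ ^ 2) / ‖1 - star a * w‖ ^ 2 := by
        rw [norm_div, div_pow, ← hid, add_div, div_self (pow_ne_zero 2 hd.ne')]
      rw [this, Real.sqrt_div (by positivity), Real.sqrt_sq hd.le, Real.sqrt_mul hw.le,
        div_mul_eq_mul_div, mul_assoc, Real.mul_self_sqrt hwa.le]
    rw [e1, e2]
    have : √(1 + ‖w‖ ^ 2) ≠ 0 := (Real.sqrt_pos.2 hw).ne'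
    field_simp

/-- The only value missed is the antipode `-1 / star a` of `a` (or `∞` for `a = 0`), a full diameter
away. -/
theorem chordalDist_of_notMem_range_rotation {a : ℂ} {x : OnePoint ℂ}
    (hx : x ∉ range (rotation a)) : chordalDist x a = 2 := by
  induction x using OnePoint.rec with
  | infty =>
    have ha : a = 0 := by
      by_contra ha
      refine hx ⟨(star a)⁻¹, ?_⟩
      simp [rotation, ha]
    subst ha
    change 2 / √(1 + ‖(0 : ℂ)‖ ^ 2) = 2
    simp
  | coe z =>
    have hz : 1 + star a * z = 0 := by
      by_contra hz
      have h1 := one_add_normSq_ne_zero a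
      refine hx ⟨(z - a) / (1 + star a * z), ?_⟩
      generalize hd : 1 + star a * z = d at hz
      have e : 1 - star a * ((z - a) / d) = (1 + a * star a) / d := by
        field_simp
        linear_combination -hd
      rw [rotation, e, if_neg (div_ne_zero h1 hz)]
      congr 1
      field_simp
      linear_combination -a * hd
    change 2 * ‖z - a‖ / (√(1 + ‖z‖ ^ 2) * √(1 + ‖a‖ ^ 2)) = 2
    have hid := norm_add_sq_add_norm_one_sub_sq (-a) z
    have h0 : 1 - star (-a) * z = 0 := by rw [← hz, star_neg]; ring
    rw [h0, norm_zero, norm_neg, ← sub_eq_add_neg] at hid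
    have : √(1 + ‖z‖ ^ 2) * √(1 + ‖a‖ ^ 2) = ‖z - a‖ := by
      rw [← Real.sqrt_mul (by positivity), ← hid]
      simp [Real.sqrt_sq (norm_nonneg _)]
    have hp : 0 < √(1 + ‖z‖ ^ 2) * √(1 + ‖a‖ ^ 2) := by positivity
    rw [this] at hp ⊢
    field_simp

theorem exists_sphereChart (a : OnePoint ℂ) : ∃ S : ℂ → OnePoint ℂ, IsOpenEmbedding S ∧ S 0 = a ∧
    (∀ w, sphericalDist (S w) a = 2 * Real.arctan ‖w‖) ∧
    ∀ x, x ∉ range S → sphericalDist x a = Real.pi := by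
  induction a using OnePoint.rec with
  | infty =>
    refine ⟨recip, isOpenEmbedding_recip, recip_zero, fun w => ?_, fun x hx => ?_⟩
    · apply sphericalDist_eq_of_chordalDist
      by_cases hw : w = 0
      · rw [hw, recip_zero]
        change (0 : ℝ) = _
        simp
      · rw [recip_of_ne_zero hw]
        change 2 / √(1 + ‖w⁻¹‖ ^ 2) = _
        have hp : 0 < ‖w‖ := norm_pos_iff.2 hw
        have : √(1 + ‖w⁻¹‖ ^ 2) = √(1 + ‖w‖ ^ 2) / ‖w‖ := by
          rw [← Real.sqrt_sq hp.le, ← Real.sqrt_div (by positivity), Real.sqrt_sq hp.le, norm_inv]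
          congr 1
          field_simp
          ring
        rw [this]
        field_simp
    · apply sphericalDist_eq_pi
      induction x using OnePoint.rec with
      | infty => exact absurd ⟨0, recip_zero⟩ hx
      | coe z =>
        have hz : z = 0 := by
          by_contra hz
          exact hx ⟨z⁻¹, by rw [recip_of_ne_zero (inv_ne_zero hz), inv_inv]⟩
        subst hz
        change 2 / √(1 + ‖(0 : ℂ)‖ ^ 2) = 2
        simp
  | coe a =>
    exact ⟨rotation a, isOpenEmbedding_rotation a, by simp [rotation],
      fun w => sphericalDist_eq_of_chordalDist (chordalDist_rotation a w),
      fun x hx => sphericalDist_eq_pi (chordalDist_of_notMem_range_rotation hx)⟩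

/-- A chart of the Riemann sphere centred at `a`, whose balls are the spherical disks. -/
def sphereChart (a : OnePoint ℂ) : ℂ → OnePoint ℂ := (exists_sphereChart a).choose

theorem isOpenEmbedding_sphereChart (a : OnePoint ℂ) : IsOpenEmbedding (sphereChart a) :=
  (exists_sphereChart a).choose_spec.1

@[simp]
theorem sphereChart_zero (a : OnePoint ℂ) : sphereChart a 0 = a :=
  (exists_sphereChart a).choose_spec.2.1

theorem sphericalDist_sphereChart (a : OnePoint ℂ) (w : ℂ) :
    sphericalDist (sphereChart a w) a = 2 * Real.arctan ‖w‖ :=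
  (exists_sphereChart a).choose_spec.2.2.1 w

theorem sphericalDist_of_notMem_range {a x : OnePoint ℂ} (hx : x ∉ range (sphereChart a)) :
    sphericalDist x a = Real.pi :=
  (exists_sphereChart a).choose_spec.2.2.2 x hx

/-! ### Spherical disks read in the centred chart. -/

theorem sphericalDisk_mono (a : OnePoint ℂ) : Monotone (sphericalDisk a) :=
  fun _ _ h _ hw => lt_of_lt_of_le hw h

theorem sphericalDisk_subset_range {a : OnePoint ℂ} {ρ : ℝ} (hρ : ρ ≤ Real.pi) :
    sphericalDisk a ρ ⊆ range (sphereChart a) := by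
  intro x hx
  by_contra h
  have : sphericalDist x a < ρ := hx
  rw [sphericalDist_of_notMem_range h] at this
  linarith

/-- The radius of the ball of `ℂ` that corresponds to the spherical disk of radius `ρ < π`. -/
def flatRadius (ρ : ℝ) : ℝ := Real.tan (ρ / 2)

theorem flatRadius_pos {ρ : ℝ} (h0 : 0 < ρ) (hρ : ρ < Real.pi) : 0 < flatRadius ρ :=
  Real.tan_pos_of_pos_of_lt_pi_div_two (by linarith) (by linarith)

theorem flatRadius_lt {ρ ρ' : ℝ} (h0 : 0 < ρ) (h : ρ < ρ') (hρ : ρ' < Real.pi) :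
    flatRadius ρ < flatRadius ρ' :=
  Real.tan_lt_tan_of_nonneg_of_lt_pi_div_two (by linarith) (by linarith) (by linarith)

theorem sphereChart_mem_disk {a : OnePoint ℂ} {ρ : ℝ} (h0 : 0 < ρ) (hρ : ρ < Real.pi) {w : ℂ} :
    sphereChart a w ∈ sphericalDisk a ρ ↔ ‖w‖ < flatRadius ρ := by
  change sphericalDist _ _ < ρ ↔ _
  rw [sphericalDist_sphereChart, flatRadius]
  have h1 : Real.arctan (Real.tan (ρ / 2)) = ρ / 2 :=
    Real.arctan_tan (by linarith) (by linarith)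
  rw [← Real.arctan_strictMono.lt_iff_lt (b := Real.tan (ρ / 2)), h1]
  constructor <;> intro h <;> linarith

theorem sphericalDisk_eq_image {a : OnePoint ℂ} {ρ : ℝ} (h0 : 0 < ρ) (hρ : ρ < Real.pi) :
    sphericalDisk a ρ = sphereChart a '' Metric.ball 0 (flatRadius ρ) := by
  ext x
  constructor
  · intro hx
    obtain ⟨w, rfl⟩ := sphericalDisk_subset_range hρ.le hx
    exact ⟨w, by simpa using (sphereChart_mem_disk h0 hρ).1 hx, rfl⟩
  · rintro ⟨w, hw, rfl⟩
    exact (sphereChart_mem_disk h0 hρ).2 (by simpa using hw)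

theorem sphericalDisk_pi (a : OnePoint ℂ) :
    sphericalDisk a Real.pi = range (sphereChart a) := by
  refine (sphericalDisk_subset_range le_rfl).antisymm ?_
  rintro _ ⟨w, rfl⟩
  change sphericalDist _ _ < _
  rw [sphericalDist_sphereChart]
  linarith [Real.arctan_lt_pi_div_two ‖w‖]

theorem sphericalDisk_of_pi_lt (a : OnePoint ℂ) {ρ : ℝ} (hρ : Real.pi < ρ) :
    sphericalDisk a ρ = univ := by
  refine eq_univ_of_forall fun x => ?_
  by_cases hx : x ∈ range (sphereChart a)
  · exact sphericalDisk_mono a hρ.le (by rwa [sphericalDisk_pi])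
  · change sphericalDist _ _ < _
    rwa [sphericalDist_of_notMem_range hx]

theorem isOpen_sphericalDisk (a : OnePoint ℂ) {ρ : ℝ} (h0 : 0 < ρ) :
    IsOpen (sphericalDisk a ρ) := by
  rcases lt_trichotomy ρ Real.pi with h | h | h
  · rw [sphericalDisk_eq_image h0 h]
    exact (isOpenEmbedding_sphereChart a).isOpenMap _ Metric.isOpen_ball
  · rw [h, sphericalDisk_pi]
    exact (isOpenEmbedding_sphereChart a).isOpen_range
  · rw [sphericalDisk_of_pi_lt a h]
    exact isOpen_univ

theorem mem_sphericalDisk_self (a : OnePoint ℂ) {ρ : ℝ} (h0 : 0 < ρ) : a ∈ sphericalDisk a ρ := by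
  have := sphericalDist_sphereChart a 0
  rw [sphereChart_zero] at this
  change sphericalDist a a < ρ
  rw [this]
  simpa using h0

theorem sphericalDisk_mem_nhds (a : OnePoint ℂ) {ρ : ℝ} (h0 : 0 < ρ) :
    sphericalDisk a ρ ∈ 𝓝 a :=
  (isOpen_sphericalDisk a h0).mem_nhds (mem_sphericalDisk_self a h0)

/-- Small spherical disks are contained in a given neighbourhood of the centre. -/
theorem exists_sphericalDisk_subset {a : OnePoint ℂ} {N : Set (OnePoint ℂ)} (hN : N ∈ 𝓝 a)
    {r : ℝ} (hr : 0 < r) : ∃ ρ, 0 < ρ ∧ ρ < r ∧ ρ < Real.pi ∧ sphericalDisk a ρ ⊆ N := by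
  have h1 : sphereChart a ⁻¹' N ∈ 𝓝 (0 : ℂ) :=
    (isOpenEmbedding_sphereChart a).continuous.continuousAt (by simpa using hN)
  obtain ⟨ε, hε, hεN⟩ := Metric.mem_nhds_iff.1 h1
  have hpos : 0 < min (2 * Real.arctan ε) r := lt_min (by simpa using Real.arctan_pos.2 hε) hr
  refine ⟨min (2 * Real.arctan ε) r / 2, by linarith, ?_, ?_, ?_⟩
  · linarith [min_le_right (2 * Real.arctan ε) r]
  · linarith [min_le_left (2 * Real.arctan ε) r, Real.arctan_lt_pi_div_two ε, Real.pi_pos]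
  · intro x hx
    have hle : min (2 * Real.arctan ε) r / 2 ≤ 2 * Real.arctan ε := by
      linarith [min_le_left (2 * Real.arctan ε) r]
    have hx' := sphericalDisk_mono a hle hx
    obtain ⟨w, rfl⟩ := sphericalDisk_subset_range
      (by linarith [Real.arctan_lt_pi_div_two ε]) hx'
    apply hεN
    change sphericalDist _ _ < _ at hx'
    rw [sphericalDist_sphereChart] at hx'
    have : Real.arctan ‖w‖ < Real.arctan ε := by linarith
    simpa using Real.arctan_strictMono.lt_iff_lt.1 this

theorem eq_of_forall_mem_sphericalDisk {a x : OnePoint ℂ}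
    (h : ∀ ρ, 0 < ρ → x ∈ sphericalDisk a ρ) : x = a := by
  by_contra hne
  obtain ⟨ρ, h0, -, -, hs⟩ := exists_sphericalDisk_subset (isOpen_ne.mem_nhds (Ne.symm hne)) one_pos
  exact hs (h ρ h0) rfl

/-- A limit point of the disk of radius `ρ < π` is the image of a point of the closed ball. -/
theorem closure_sphericalDisk_subset {a : OnePoint ℂ} {ρ : ℝ} (h0 : 0 < ρ) (hρ : ρ < Real.pi) :
    closure (sphericalDisk a ρ) ⊆ sphereChart a '' Metric.closedBall 0 (flatRadius ρ) := by
  refine closure_minimal ?_ ?_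
  · rw [sphericalDisk_eq_image h0 hρ]
    exact image_mono Metric.ball_subset_closedBall
  · exact ((isCompact_closedBall _ _).image (isOpenEmbedding_sphereChart a).continuous).isClosed

theorem closure_sphericalDisk_subset_disk {a : OnePoint ℂ} {ρ ρ' : ℝ} (h0 : 0 < ρ) (h : ρ < ρ')
    (hρ : ρ < Real.pi) : closure (sphericalDisk a ρ) ⊆ sphericalDisk a ρ' := by
  -- The radius `ρ'` may exceed `π`, where the chart no longer describes the disk, so a radius below
  -- both is interposed.
  obtain ⟨ρ'', h1, h2⟩ := exists_between (lt_min h hρ)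
  refine (closure_sphericalDisk_subset h0 hρ).trans ?_
  refine Subset.trans ?_ (sphericalDisk_mono a (h2.le.trans (min_le_left _ _)))
  have hpi := h2.trans_le (min_le_right _ _)
  rw [sphericalDisk_eq_image (h0.trans h1) hpi]
  exact image_mono (Metric.closedBall_subset_ball (flatRadius_lt h0 h1 hpi))

/-! ### Lifting paths through local homeomorphisms -/

section PathLifting

variable {X Y : Type*} [TopologicalSpace X] [TopologicalSpace Y] {q : X → Y}

/-- The closedness half of a continuity argument: lifts over shorter intervals agree by uniqueness,
glue to a lift on `[0, t)`, and the assumed limit supplies the value at `t`. -/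
theorem exists_lift_Icc_of_closure {γ : ℝ → Y} {x₀ : X} [T2Space X] [T2Space Y]
    (hq : IsLocalHomeomorph q) (hγ : Continuous γ) {t : ℝ} (ht : 0 < t)
    (hlim : ∀ c : ℝ → X, ContinuousOn c (Ico 0 t) → (∀ s ∈ Ico 0 t, q (c s) = γ s) →
      ∃ x, Tendsto c (𝓝[<] t) (𝓝 x))
    (hlift : ∀ s ∈ Ico 0 t, ∃ t' > s, ∃ c : ℝ → X, ContinuousOn c (Icc 0 t') ∧ c 0 = x₀ ∧
      ∀ u ∈ Icc 0 t', q (c u) = γ u) :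
    ∃ c : ℝ → X, ContinuousOn c (Icc 0 t) ∧ c 0 = x₀ ∧ ∀ s ∈ Icc 0 t, q (c s) = γ s := by
  have : Nonempty X := ⟨x₀⟩
  choose! T hT C hC hC0 hCq using hlift
  have agree : ∀ s ∈ Ico 0 t, ∀ u ∈ Ico 0 t, u ≤ T s → C u u = C s u := by
    intro s hs u hu hus
    have h1 : Icc 0 u ⊆ Icc 0 (T u) := Icc_subset_Icc_right (hT u hu).le
    have h2 : Icc 0 u ⊆ Icc 0 (T s) := Icc_subset_Icc_right hus
    refine (T2Space.isSeparatedMap q).eqOn_of_comp_eqOn hq.isLocallyInjective isPreconnected_Icc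
      ((hC u hu).mono h1) ((hC s hs).mono h2) (fun v hv => ?_) (left_mem_Icc.2 hu.1)
      ((hC0 u hu).trans (hC0 s hs).symm) (right_mem_Icc.2 hu.1)
    exact (hCq u hu v (h1 hv)).trans (hCq s hs v (h2 hv)).symm
  -- The diagonal choice; near `s` it coincides with the single continuous lift `C s`.
  let c : ℝ → X := fun s => C s s
  have hcq : ∀ s ∈ Ico 0 t, q (c s) = γ s := fun s hs => hCq s hs s ⟨hs.1, (hT s hs).le⟩
  have hcc : ContinuousOn c (Ico 0 t) := by
    intro s hs
    have h1 : ContinuousWithinAt (C s) (Ico 0 t ∩ Iic (T s)) s :=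
      (hC s hs s ⟨hs.1, (hT s hs).le⟩).mono fun u hu => ⟨hu.1.1, hu.2⟩
    have h2 : ContinuousWithinAt c (Ico 0 t ∩ Iic (T s)) s :=
      h1.congr (fun u hu => agree s hs u hu.1 hu.2) rfl
    exact (continuousWithinAt_inter (Iic_mem_nhds (hT s hs))).1 h2
  obtain ⟨x, hx⟩ := hlim c hcc hcq
  have hqx : q x = γ t := by
    have h1 : Tendsto (fun s => q (c s)) (𝓝[<] t) (𝓝 (q x)) :=
      (hq.continuous.tendsto x).comp hx
    have h2 : Tendsto γ (𝓝[<] t) (𝓝 (γ t)) := hγ.continuousAt.tendsto.mono_left nhdsWithin_le_nhds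
    refine tendsto_nhds_unique (h1.congr' ?_) h2
    filter_upwards [Ico_mem_nhdsLT ht] with s hs using hcq s hs
  refine ⟨Function.update c t x, ?_, ?_, ?_⟩
  · rw [continuousOn_update_iff, Icc_sdiff_right, nhdsWithin_Ico_eq_nhdsLT ht]
    exact ⟨hcc, fun _ => hx⟩
  · rw [Function.update_of_ne ht.ne]
    exact hC0 0 ⟨le_rfl, ht⟩
  · intro s hs
    rcases hs.2.eq_or_lt with h | h
    · rw [h, Function.update_self, hqx]
    · rw [Function.update_of_ne h.ne]
      exact hcq s ⟨hs.1, h⟩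

/-- The openness half: past `t` the lift continues by the local inverse of `q` at its endpoint. -/
theorem exists_lift_Icc_eventually {γ : ℝ → Y} {x₀ : X} (hq : IsLocalHomeomorph q)
    (hγ : Continuous γ) {t : ℝ} (ht : 0 ≤ t) {c : ℝ → X} (hc : ContinuousOn c (Icc 0 t))
    (hc0 : c 0 = x₀) (hcq : ∀ u ∈ Icc 0 t, q (c u) = γ u) :
    ∀ᶠ s in 𝓝[>] t, ∃ c : ℝ → X, ContinuousOn c (Icc 0 s) ∧ c 0 = x₀ ∧
      ∀ u ∈ Icc 0 s, q (c u) = γ u := by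
  obtain ⟨φ, hφ, rfl⟩ := hq (c t)
  have hmem : γ t ∈ φ.target := by
    rw [← hcq t ⟨ht, le_rfl⟩]
    exact φ.map_source hφ
  have hnhds : γ ⁻¹' φ.target ∈ 𝓝 t := hγ.continuousAt (φ.open_target.mem_nhds hmem)
  obtain ⟨δ, hδ, hδs⟩ := Metric.mem_nhds_iff.1 hnhds
  filter_upwards [Ioo_mem_nhdsGT (show t < t + δ by linarith)] with s hs
  have hsub : Icc t s ⊆ γ ⁻¹' φ.target := fun u hu => hδs (by
    rw [Metric.mem_ball, Real.dist_eq, abs_lt]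
    constructor <;> linarith [hu.1, hu.2, hs.2])
  let c' : ℝ → X := fun u => if u ≤ t then c u else φ.symm (γ u)
  have e1 : EqOn c' c (Icc 0 t) := fun u hu => if_pos hu.2
  have e2 : EqOn c' (fun u => φ.symm (γ u)) (Icc t s) := by
    intro u hu
    rcases hu.1.eq_or_lt with h | h
    · subst h
      have h1 : c' t = c t := if_pos le_rfl
      rw [h1]
      change _ = φ.symm (γ t)
      rw [← hcq t ⟨ht, le_rfl⟩, φ.left_inv hφ]
    · exact if_neg (not_le.2 h)
  refine ⟨c', ?_, (e1 ⟨le_rfl, ht⟩).trans hc0, fun u hu => ?_⟩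
  · rw [← Icc_union_Icc_eq_Icc ht hs.1.le]
    refine (hc.congr e1).union_of_isClosed ?_ isClosed_Icc isClosed_Icc
    exact (φ.continuousOn_symm.comp hγ.continuousOn hsub).congr e2
  · rcases le_total u t with h | h
    · rw [e1 ⟨hu.1, h⟩]
      exact hcq u ⟨hu.1, h⟩
    · rw [e2 ⟨h, hu.2⟩]
      exact φ.right_inv (hsub ⟨h, hu.2⟩)

/-- A path lifts through a local homeomorphism if all its half-open partial lifts converge. -/
theorem exists_path_lift_of_forall_tendsto [T2Space X] [T2Space Y] (hq : IsLocalHomeomorph q)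
    (γ : C(I, Y)) {x₀ : X} (h0 : q x₀ = γ 0)
    (hlim : ∀ t ∈ Ioc (0 : ℝ) 1, ∀ c : ℝ → X, ContinuousOn c (Ico 0 t) →
      (∀ s ∈ Ico 0 t, q (c s) = γ (projIcc 0 1 zero_le_one s)) →
      ∃ x, Tendsto c (𝓝[<] t) (𝓝 x)) :
    ∃ Γ : C(I, X), Γ 0 = x₀ ∧ ∀ t, q (Γ t) = γ t := by
  let g : ℝ → Y := fun s => γ (projIcc 0 1 zero_le_one s)
  have hg : Continuous g := γ.continuous.comp continuous_projIcc
  let A : Set ℝ := {t | ∃ c : ℝ → X, ContinuousOn c (Icc 0 t) ∧ c 0 = x₀ ∧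
    ∀ u ∈ Icc 0 t, q (c u) = g u}
  have hdown : ∀ t ∈ A, ∀ s ≤ t, s ∈ A := by
    rintro t ⟨c, h1, h2, h3⟩ s hs
    exact ⟨c, h1.mono (Icc_subset_Icc_right hs), h2, fun u hu => h3 u ⟨hu.1, hu.2.trans hs⟩⟩
  have h0A : (0 : ℝ) ∈ A := by
    refine ⟨fun _ => x₀, continuousOn_const, rfl, fun u hu => ?_⟩
    have : u = 0 := le_antisymm hu.2 hu.1
    subst this
    rw [h0]
    change _ = γ (projIcc 0 1 zero_le_one 0)
    rw [projIcc_left]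
    rfl
  have hsub : Icc (0 : ℝ) 1 ⊆ A := by
    refine IsClosed.Icc_subset_of_forall_mem_nhdsWithin ?_ h0A ?_
    · refine isClosed_of_closure_subset fun t ht => ?_
      have htI : t ∈ Icc (0 : ℝ) 1 :=
        closure_minimal inter_subset_right isClosed_Icc ht
      refine ⟨?_, htI⟩
      rcases htI.1.eq_or_lt with h | h
      · rwa [← h]
      by_contra htA
      refine htA (exists_lift_Icc_of_closure hq hg h (hlim t ⟨h, htI.2⟩) fun s hs => ?_)
      obtain ⟨t', ht', ht'A, -⟩ := mem_closure_iff.1 ht (Ioi s) isOpen_Ioi hs.2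
      exact ⟨t', ht', ht'A⟩
    · rintro t ⟨⟨c, h1, h2, h3⟩, ht⟩
      exact exists_lift_Icc_eventually hq hg ht.1 h1 h2 h3
  obtain ⟨c, h1, h2, h3⟩ := hsub (right_mem_Icc.2 zero_le_one)
  refine ⟨⟨fun t => c t, h1.comp_continuous continuous_subtype_val fun t => t.2⟩, h2, fun t => ?_⟩
  have := h3 t t.2
  simpa [g] using this

end PathLifting

/-! ### Local homeomorphisms to a disk that are uniformised by the exponential map -/

/-- `F` is a lift of the exponential map through `q`, over the subset `Ω` of `ℂ`. -/
structure IsExpLift {X : Type*} [TopologicalSpace X] (q : X → ℂ) (Ω : Set ℂ) (F : ℂ → X) :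
    Prop where
  continuousOn : ContinuousOn F (Complex.exp ⁻¹' Ω)
  apply_eq : ∀ z, Complex.exp z ∈ Ω → q (F z) = Complex.exp z

theorem exp_preimage_ball {r : ℝ} (hr : 0 < r) :
    Complex.exp ⁻¹' Metric.ball 0 r = {z | z.re < Real.log r} := by
  ext z
  simp [Complex.norm_exp, Real.lt_log_iff_exp_lt hr]

theorem convex_exp_preimage_ball {r : ℝ} (hr : 0 < r) :
    Convex ℝ (Complex.exp ⁻¹' Metric.ball 0 r) := by
  rw [exp_preimage_ball hr]
  exact convex_halfSpace_re_lt _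

section ExpLift

variable {X : Type*} [TopologicalSpace X] [T2Space X] {q : X → ℂ} {Ω : Set ℂ} {F : ℂ → X}

theorem exists_isExpLift (hq : IsLocalHomeomorph q) (hΩ : Convex ℝ (Complex.exp ⁻¹' Ω))
    (hlift : ∀ γ : C(I, ℂ), (∀ t, γ t ∈ Ω ∧ γ t ≠ 0) → ∀ x, q x = γ 0 →
      ∃ Γ : C(I, X), Γ 0 = x ∧ ∀ t, q (Γ t) = γ t)
    {z₀ : ℂ} (hz₀ : Complex.exp z₀ ∈ Ω) {x₀ : X} (hx₀ : q x₀ = Complex.exp z₀) :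
    ∃ F, IsExpLift q Ω F := by
  classical
  -- The point `F z` will be the endpoint of the lift of the `exp`-image of the segment from `z₀` to
  -- `z`; convexity keeps the segment in the domain.
  let f : C(I × (Complex.exp ⁻¹' Ω), ℂ) :=
    ⟨fun p => Complex.exp ((1 - (p.1 : ℝ)) • z₀ + (p.1 : ℝ) • (p.2 : ℂ)), by fun_prop⟩
  have hf : ∀ p, f p ∈ Ω ∧ f p ≠ 0 := fun p =>
    ⟨hΩ hz₀ p.2.2 (by linarith [p.1.2.2]) p.1.2.1 (by ring), Complex.exp_ne_zero _⟩
  have hex : ∀ z : Complex.exp ⁻¹' Ω, ∃ Γ : C(I, X), Γ 0 = x₀ ∧ ∀ t, q (Γ t) = f (t, z) := by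
    intro z
    exact hlift (f.comp ⟨fun t => (t, z), by fun_prop⟩) (fun t => hf _) x₀ (by simp [f, hx₀])
  choose Γ hΓ0 hΓq using hex
  have hcont : Continuous fun p : I × (Complex.exp ⁻¹' Ω) => Γ p.2 p.1 :=
    -- Lifts chosen separately for each `z` are jointly continuous because they start at the same
    -- point.
    hq.continuous_lift (T2Space.isSeparatedMap q) f (funext fun p => hΓq p.2 p.1)
      (by simpa only [hΓ0] using continuous_const) fun z => (Γ z).continuous
  refine ⟨fun z => if h : z ∈ Complex.exp ⁻¹' Ω then Γ ⟨z, h⟩ 1 else x₀, ?_, fun z hz => ?_⟩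
  · rw [continuousOn_iff_continuous_domRestrict]
    refine (hcont.comp (Continuous.prodMk_right (1 : I))).congr fun z => ?_
    simp only [Function.comp, Set.domRestrict_apply]
    rw [dif_pos z.2]
  · rw [dif_pos (show z ∈ Complex.exp ⁻¹' Ω from hz), hΓq]
    simp [f]

namespace IsExpLift

theorem eqOn_of_eq (hq : IsLocalHomeomorph q) {F' : ℂ → X} {K : Set ℂ} (hF : IsExpLift q Ω F)
    (hK : IsPreconnected K) (hKΩ : K ⊆ Complex.exp ⁻¹' Ω) (hF'c : ContinuousOn F' K)
    (hF'q : ∀ z ∈ K, q (F' z) = Complex.exp z) {z : ℂ} (hz : z ∈ K) (h : F z = F' z) :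
    EqOn F F' K :=
  (T2Space.isSeparatedMap q).eqOn_of_comp_eqOn hq.isLocallyInjective hK (hF.continuousOn.mono hKΩ)
    hF'c (fun w hw => (hF.apply_eq w (hKΩ hw)).trans (hF'q w hw).symm) hz h

/-- Away from the zeros of `q` the image of `F` is open and closed: composing `F` with a branch of
the logarithm gives a section of `q` on a small ball, which equals the sheet through `y` once they
share a point. -/
theorem exists_nhds_of_ne_zero (hq : IsLocalHomeomorph q) (hΩ : IsOpen Ω) (hqΩ : ∀ x, q x ∈ Ω)
    (hF : IsExpLift q Ω F) {y : X} (hy : q y ≠ 0) :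
    ∃ N ∈ 𝓝 y, (N ∩ F '' (Complex.exp ⁻¹' Ω)).Nonempty → N ⊆ F '' (Complex.exp ⁻¹' Ω) := by
  obtain ⟨φ, hφ, hφq⟩ := hq y
  have hmem : φ.target ∩ Ω ∈ 𝓝 (q y) :=
    inter_mem (φ.open_target.mem_nhds (hφq ▸ φ.map_source hφ)) (hΩ.mem_nhds (hqΩ y))
  obtain ⟨ε', hε', hεs'⟩ := Metric.mem_nhds_iff.1 hmem
  have hny : 0 < ‖q y‖ := norm_pos_iff.2 hy
  -- For `w` and `exp h` in the ball, `‖w - exp h‖ < 2ε ≤ ‖q y‖ - ε < ‖exp h‖`; so `w / exp h` is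
  -- within `1` of `1` and the principal logarithm applies.
  obtain ⟨ε, hε, hεs, hε3⟩ : ∃ ε > 0, Metric.ball (q y) ε ⊆ φ.target ∩ Ω ∧ 3 * ε ≤ ‖q y‖ :=
    ⟨min ε' (‖q y‖ / 3), by positivity, (Metric.ball_subset_ball (min_le_left _ _)).trans hεs',
      by linarith [min_le_right ε' (‖q y‖ / 3)]⟩
  refine ⟨φ.source ∩ q ⁻¹' Metric.ball (q y) ε, inter_mem (φ.open_source.mem_nhds hφ)
    (hq.continuous.continuousAt (Metric.ball_mem_nhds _ hε)), ?_⟩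
  rintro ⟨_, ⟨hn1, hn2⟩, ⟨h, hh, rfl⟩⟩ n ⟨hm1, hm2⟩
  have hqF : q (F h) = Complex.exp h := hF.apply_eq h hh
  rw [mem_preimage, hqF] at hn2
  let ℓ : ℂ → ℂ := fun w => h + Complex.log (w / Complex.exp h)
  have hslit : ∀ w ∈ Metric.ball (q y) ε, w / Complex.exp h ∈ Complex.slitPlane := by
    intro w hw
    have h1 : ‖w / Complex.exp h - 1‖ < 1 := by
      have hlow : ‖q y‖ - ‖Complex.exp h‖ ≤ ‖Complex.exp h - q y‖ := by
        rw [norm_sub_rev]; exact norm_sub_norm_le _ _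
      rw [mem_ball_iff_norm] at hw hn2
      have h2 : ‖w - Complex.exp h‖ < ‖Complex.exp h‖ := by
        have : ‖w - Complex.exp h‖ ≤ ‖w - q y‖ + ‖Complex.exp h - q y‖ := by
          rw [norm_sub_rev (Complex.exp h)]
          exact norm_sub_le_norm_sub_add_norm_sub _ _ _
        linarith
      rw [div_sub_one (Complex.exp_ne_zero h), norm_div, div_lt_one]
      · exact h2
      · exact norm_pos_iff.2 (Complex.exp_ne_zero h)
    simpa using Complex.mem_slitPlane_of_norm_lt_one h1
  have hℓ : ∀ w ∈ Metric.ball (q y) ε, Complex.exp (ℓ w) = w := by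
    intro w hw
    simp only [ℓ]
    rw [Complex.exp_add, Complex.exp_log (Complex.slitPlane_ne_zero (hslit w hw)),
      mul_div_cancel₀ _ (Complex.exp_ne_zero h)]
  have hℓc : ContinuousOn ℓ (Metric.ball (q y) ε) := by
    refine continuousOn_const.add (ContinuousOn.clog ?_ hslit)
    exact continuousOn_id.div_const _
  have hmaps : MapsTo ℓ (Metric.ball (q y) ε) (Complex.exp ⁻¹' Ω) := fun w hw => by
    rw [mem_preimage, hℓ w hw]
    exact (hεs hw).2
  have key : EqOn (F ∘ ℓ) φ.symm (Metric.ball (q y) ε) := by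
    refine (T2Space.isSeparatedMap q).eqOn_of_comp_eqOn hq.isLocallyInjective
      (convex_ball _ _).isPreconnected (hF.continuousOn.comp hℓc hmaps)
      (φ.continuousOn_symm.mono fun w hw => (hεs hw).1) (fun w hw => ?_) hn2 ?_
    · simp only [Function.comp]
      rw [hF.apply_eq _ (hmaps hw), hℓ w hw, hφq, φ.right_inv (hεs hw).1]
    · simp only [Function.comp, ℓ]
      rw [div_self (Complex.exp_ne_zero h), Complex.log_one, add_zero, ← hqF, hφq, φ.left_inv hn1]
  refine ⟨ℓ (q n), hmaps hm2, (key hm2).trans ?_⟩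
  rw [hφq, φ.left_inv hm1]

theorem isPreconnected_exp_preimage_ball {r : ℝ} (hr : 0 < r) :
    IsPreconnected (Complex.exp ⁻¹' Metric.ball 0 r) :=
  (convex_exp_preimage_ball hr).isPreconnected

/-- Once `F` enters a sheet over a full ball around `0`, uniqueness of lifts keeps it there over the
whole smaller half-plane. -/
theorem eqOn_symm_comp_exp (hq : IsLocalHomeomorph q) (hF : IsExpLift q Ω F)
    {φ : OpenPartialHomeomorph X ℂ} (hφq : q = φ) {ε : ℝ} (hε : 0 < ε)
    (hεs : Metric.ball 0 ε ⊆ φ.target ∩ Ω) {z : ℂ} (hz : Complex.exp z ∈ Metric.ball 0 ε)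
    (hFz : F z ∈ φ.source) :
    EqOn F (fun w => φ.symm (Complex.exp w)) (Complex.exp ⁻¹' Metric.ball 0 ε) := by
  refine hF.eqOn_of_eq hq (isPreconnected_exp_preimage_ball hε) (fun w hw => (hεs hw).2)
    (φ.continuousOn_symm.comp Complex.continuous_exp.continuousOn fun w hw => (hεs hw).1)
    (fun w hw => ?_) hz ?_
  · rw [hφq, φ.right_inv (hεs hw).1]
  · rw [← hF.apply_eq z (hεs hz).2, hφq, φ.left_inv hFz]

theorem exists_nhds_of_eq_zero (hq : IsLocalHomeomorph q) (hΩ : IsOpen Ω) (hqΩ : ∀ x, q x ∈ Ω)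
    (hF : IsExpLift q Ω F) {y : X} (hy : q y = 0) :
    ∃ N ∈ 𝓝 y, (N ∩ F '' (Complex.exp ⁻¹' Ω)).Nonempty →
      N \ {y} ⊆ F '' (Complex.exp ⁻¹' Ω) := by
  obtain ⟨φ, hφ, hφq⟩ := hq y
  have hmem : φ.target ∩ Ω ∈ 𝓝 (q y) :=
    inter_mem (φ.open_target.mem_nhds (hφq ▸ φ.map_source hφ)) (hΩ.mem_nhds (hqΩ y))
  rw [hy] at hmem
  obtain ⟨ε, hε, hεs⟩ := Metric.mem_nhds_iff.1 hmem
  refine ⟨φ.source ∩ q ⁻¹' Metric.ball 0 ε, inter_mem (φ.open_source.mem_nhds hφ)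
    (hq.continuous.continuousAt (hy ▸ Metric.ball_mem_nhds _ hε)), ?_⟩
  rintro ⟨_, ⟨hn1, hn2⟩, ⟨h, hh, rfl⟩⟩ n ⟨⟨hm1, hm2⟩, hne⟩
  rw [mem_preimage, hF.apply_eq h hh] at hn2
  have key := hF.eqOn_symm_comp_exp hq hφq hε hεs hn2 hn1
  have hqn : q n ≠ 0 := fun h0 => hne (φ.injOn hm1 hφ (by rw [← hφq, h0, hy]))
  have hexp : Complex.exp (Complex.log (q n)) = q n := Complex.exp_log hqn
  have hmem : Complex.log (q n) ∈ Complex.exp ⁻¹' Metric.ball 0 ε := by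
    rw [mem_preimage, hexp]; exact hm2
  refine ⟨Complex.log (q n), (hεs hmem).2, (key hmem).trans ?_⟩
  simp only [hexp]
  rw [hφq, φ.left_inv hm1]

/-- A lift of the exponential map attains every point outside the fibre over `0`. -/
theorem exists_eq [PreconnectedSpace X] (hq : IsLocalHomeomorph q) (hΩ : IsOpen Ω)
    (hqΩ : ∀ x, q x ∈ Ω) (hne : (Complex.exp ⁻¹' Ω).Nonempty)
    (hF : IsExpLift q Ω F) {x : X} (hx : q x ≠ 0) : ∃ z, Complex.exp z ∈ Ω ∧ F z = x := by
  set R : Set X := F '' (Complex.exp ⁻¹' Ω) with hR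
  have hmeet : ∀ y ∈ closure R, ∀ N ∈ 𝓝 y, (N ∩ R).Nonempty := fun y hy N hN =>
    mem_closure_iff_nhds.1 hy N hN
  -- A zero of `q` is never in the image of `F`, so the image need not be closed; its closure is
  -- clopen instead.
  have hopen : IsOpen (closure R) := by
    rw [isOpen_iff_mem_nhds]
    intro y hy
    by_cases h0 : q y = 0
    · obtain ⟨N, hN, hsub⟩ := hF.exists_nhds_of_eq_zero hq hΩ hqΩ h0
      refine mem_of_superset hN fun n hn => ?_
      by_cases hny : n = y
      · rwa [hny]
      · exact subset_closure (hsub (hmeet y hy N hN) ⟨hn, hny⟩)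
    · obtain ⟨N, hN, hsub⟩ := hF.exists_nhds_of_ne_zero hq hΩ hqΩ h0
      exact mem_of_superset hN ((hsub (hmeet y hy N hN)).trans subset_closure)
  have huniv : closure R = univ :=
    IsClopen.eq_univ ⟨isClosed_closure, hopen⟩ (hne.image F).closure
  obtain ⟨N, hN, hsub⟩ := hF.exists_nhds_of_ne_zero hq hΩ hqΩ hx
  exact hsub (hmeet x (huniv ▸ mem_univ x) N hN) (mem_of_mem_nhds hN)

/-- If `q` has a zero `y`, then all points with small `q` different from zeros lie near `y`. -/
theorem exists_preconnected_of_eq_zero [PreconnectedSpace X] (hq : IsLocalHomeomorph q)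
    (hΩ : IsOpen Ω) (hqΩ : ∀ x, q x ∈ Ω) (hne : (Complex.exp ⁻¹' Ω).Nonempty)
    (hF : IsExpLift q Ω F) {y : X} (hy : q y = 0) :
    ∃ ε₀ > 0, ∀ ε, 0 < ε → ε ≤ ε₀ → ∃ N : Set X, IsPreconnected N ∧ y ∈ N ∧
      (∀ n ∈ N, ‖q n‖ < ε) ∧ ∀ x, q x ≠ 0 → ‖q x‖ < ε → x ∈ N := by
  obtain ⟨φ, hφ, hφq⟩ := hq y
  have hmem : φ.target ∩ Ω ∈ 𝓝 (q y) :=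
    inter_mem (φ.open_target.mem_nhds (hφq ▸ φ.map_source hφ)) (hΩ.mem_nhds (hqΩ y))
  rw [hy] at hmem
  obtain ⟨ε₀, hε₀, hεs⟩ := Metric.mem_nhds_iff.1 hmem
  have hhalf : ((ε₀ / 2 : ℝ) : ℂ) ∈ Metric.ball (0 : ℂ) ε₀ := by
    rw [mem_ball_zero_iff, Complex.norm_real, Real.norm_of_nonneg (by positivity)]
    linarith
  have hq1 : q (φ.symm ((ε₀ / 2 : ℝ) : ℂ)) = ((ε₀ / 2 : ℝ) : ℂ) := by
    rw [hφq, φ.right_inv (hεs hhalf).1]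
  obtain ⟨h, hh, hFh⟩ := hF.exists_eq hq hΩ hqΩ hne (x := φ.symm ((ε₀ / 2 : ℝ) : ℂ)) (by
    rw [hq1]; exact_mod_cast (by positivity : ε₀ / 2 ≠ 0))
  have key := hF.eqOn_symm_comp_exp hq hφq hε₀ hεs (z := h)
    (by rw [← hF.apply_eq h hh, hFh, hq1]; exact hhalf)
    (by rw [hFh]; exact φ.map_target (hεs hhalf).1)
  refine ⟨ε₀, hε₀, fun ε hε hle => ?_⟩
  have hball := (Metric.ball_subset_ball (x := (0 : ℂ)) hle).trans hεs
  refine ⟨φ.symm '' Metric.ball 0 ε, (convex_ball _ _).isPreconnected.image _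
    (φ.continuousOn_symm.mono fun w hw => (hball hw).1), ⟨0, by simpa using hε, ?_⟩, ?_, ?_⟩
  · rw [← hy, hφq, φ.left_inv hφ]
  · rintro _ ⟨w, hw, rfl⟩
    rw [hφq, φ.right_inv (hball hw).1]
    simpa using hw
  · intro x hx hxε
    obtain ⟨z, hz, rfl⟩ := hF.exists_eq hq hΩ hqΩ hne hx
    rw [hF.apply_eq z hz] at hxε
    exact ⟨Complex.exp z, by simpa using hxε,
      (key (show Complex.exp z ∈ Metric.ball 0 ε₀ by
        rw [mem_ball_zero_iff]; exact hxε.trans_le hle)).symm⟩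

/-- This set is the `F`-image of an intersection of two convex sets. -/
theorem isPreconnected_setOf_norm_lt [PreconnectedSpace X] (hq : IsLocalHomeomorph q)
    (hΩ : IsOpen Ω) (hΩc : Convex ℝ (Complex.exp ⁻¹' Ω)) (hqΩ : ∀ x, q x ∈ Ω)
    (hne : (Complex.exp ⁻¹' Ω).Nonempty) (hF : IsExpLift q Ω F) {ε : ℝ} (hε : 0 < ε) :
    IsPreconnected {x | q x ≠ 0 ∧ ‖q x‖ < ε} := by
  have : {x | q x ≠ 0 ∧ ‖q x‖ < ε} =
      F '' (Complex.exp ⁻¹' Ω ∩ Complex.exp ⁻¹' Metric.ball 0 ε) := by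
    ext x
    constructor
    · rintro ⟨hx, hxε⟩
      obtain ⟨z, hz, rfl⟩ := hF.exists_eq hq hΩ hqΩ hne hx
      exact ⟨z, ⟨hz, by simpa [hF.apply_eq z hz] using hxε⟩, rfl⟩
    · rintro ⟨z, ⟨hz, hzε⟩, rfl⟩
      rw [mem_ofPred, hF.apply_eq z hz]
      exact ⟨Complex.exp_ne_zero z, by simpa using hzε⟩
  rw [this]
  exact (hΩc.inter (convex_exp_preimage_ball hε)).isPreconnected.image _
    (hF.continuousOn.mono inter_subset_left)

/-- Two points with the same `F`-value differ by a multiple of `2πi`, which is then a period of `F`;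
the fibre over a circle is the image of one period of a vertical line. -/
theorem isCompact_setOf_norm_eq [PreconnectedSpace X] (hq : IsLocalHomeomorph q)
    {r : ℝ} (hr : 0 < r) (hqΩ : ∀ x, q x ∈ Metric.ball 0 r)
    (hF : IsExpLift q (Metric.ball 0 r) F)
    (hinj : ¬ InjOn F (Complex.exp ⁻¹' Metric.ball 0 r)) {ε : ℝ} (hε : 0 < ε) (hεr : ε < r) :
    IsCompact {x | ‖q x‖ = ε} := by
  have hH : ∀ z : ℂ, Complex.exp z ∈ Metric.ball (0 : ℂ) r ↔ z.re < Real.log r := fun z => by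
    have := congrArg (z ∈ ·) (exp_preimage_ball hr)
    simpa using this
  obtain ⟨n, hn, hper⟩ : ∃ n : ℤ, n ≠ 0 ∧ ∀ z : ℂ, z.re < Real.log r →
      F (z + n * (2 * Real.pi * Complex.I)) = F z := by
    simp only [InjOn, not_forall] at hinj
    obtain ⟨z, hz, w, hw, hzw, hne⟩ := hinj
    have hexp : Complex.exp z = Complex.exp w := by
      rw [← hF.apply_eq z hz, hzw, hF.apply_eq w hw]
    obtain ⟨n, rfl⟩ := Complex.exp_eq_exp_iff_exists_int.1 hexp
    have hsh : ∀ z : ℂ, Complex.exp (z + n * (2 * Real.pi * Complex.I)) = Complex.exp z :=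
      fun z => Complex.exp_eq_exp_iff_exists_int.2 ⟨n, rfl⟩
    refine ⟨n, fun h0 => hne (by simp [h0]), fun z hz => ?_⟩
    have hmaps : MapsTo (fun z : ℂ => z + n * (2 * Real.pi * Complex.I))
        (Complex.exp ⁻¹' Metric.ball 0 r) (Complex.exp ⁻¹' Metric.ball 0 r) := fun z hz => by
      rwa [mem_preimage, hsh]
    -- The translate of `F` is another lift of `exp` and agrees with `F` at one point, hence
    -- everywhere.
    refine (hF.eqOn_of_eq hq (isPreconnected_exp_preimage_ball hr) subset_rfl
      (F' := fun z => F (z + n * (2 * Real.pi * Complex.I)))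
      (hF.continuousOn.comp (by fun_prop) hmaps) (fun v hv => ?_) hw hzw.symm
      ((hH z).2 hz)).symm
    rw [hF.apply_eq _ (hmaps hv), hsh]
  let G : ℝ → X := fun θ => F (Real.log ε + θ * Complex.I)
  have hre : ∀ θ : ℝ, ((Real.log ε : ℂ) + θ * Complex.I).re < Real.log r := fun θ => by
    simpa using Real.log_lt_log hε hεr
  have hGc : Continuous G := hF.continuousOn.comp_continuous (by fun_prop) fun θ =>
    (hH _).2 (hre θ)
  have hGper : Function.Periodic G (n * (2 * Real.pi)) := fun θ => by
    simp only [G]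
    rw [← hper _ (hre θ)]
    congr 1
    push_cast
    ring
  have hset : {x | ‖q x‖ = ε} = G '' uIcc 0 (0 + n * (2 * Real.pi)) := by
    rw [hGper.image_uIcc (by simp [hn, Real.pi_ne_zero])]
    ext x
    constructor
    · intro hx
      have hx' : ‖q x‖ = ε := hx
      have hx0 : q x ≠ 0 := by
        rw [← norm_pos_iff, hx']; exact hε
      obtain ⟨z, hz, rfl⟩ := hF.exists_eq hq Metric.isOpen_ball hqΩ ⟨Complex.log (q x), by
        rw [mem_preimage, Complex.exp_log hx0]; exact hqΩ x⟩ hx0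
      rw [hF.apply_eq z hz, Complex.norm_exp] at hx'
      refine ⟨z.im, ?_⟩
      simp only [G]
      rw [← hx', Real.log_exp, Complex.re_add_im]
    · rintro ⟨θ, rfl⟩
      rw [mem_ofPred, hF.apply_eq _ ((hH _).2 (hre θ)), Complex.norm_exp]
      simp [Real.exp_log hε]
  rw [hset]
  exact isCompact_uIcc.image hGc

/-- As both `exp` and `q` are local homeomorphisms, so is `F`; being bijective, it is a
homeomorphism. -/
theorem exists_homeomorph [PreconnectedSpace X] (hq : IsLocalHomeomorph q) (hΩ : IsOpen Ω)
    (hqΩ : ∀ x, q x ∈ Ω) (hne : (Complex.exp ⁻¹' Ω).Nonempty) (hF : IsExpLift q Ω F)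
    (hq0 : ∀ x, q x ≠ 0) (hinj : InjOn F (Complex.exp ⁻¹' Ω)) :
    ∃ Φ : (Complex.exp ⁻¹' Ω) ≃ₜ X, ∀ z, q (Φ z) = Complex.exp z := by
  let f : Complex.exp ⁻¹' Ω → X := fun z => F z
  have hfc : Continuous f := continuousOn_iff_continuous_domRestrict.1 hF.continuousOn
  have hfi : Function.Injective f := hinj.injective
  have hfs : Function.Surjective f := fun x => by
    obtain ⟨z, hz, h⟩ := hF.exists_eq hq hΩ hqΩ hne (hq0 x)
    exact ⟨⟨z, hz⟩, h⟩
  have hexp : IsLocalHomeomorph fun z : Complex.exp ⁻¹' Ω => Complex.exp z := by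
    rw [isLocalHomeomorph_iff_isLocalHomeomorphOn_univ]
    have hval := (hΩ.preimage Complex.continuous_exp).isOpenEmbedding_subtypeVal.isLocalHomeomorph
    refine Complex.isCoveringMapOn_exp.isLocalHomeomorphOn.comp (s := univ)
      hval.isLocalHomeomorphOn ?_
    intro z _
    exact Complex.exp_ne_zero _
  have hcomp : q ∘ f = fun z : Complex.exp ⁻¹' Ω => Complex.exp z :=
    funext fun z => hF.apply_eq z z.2
  have hfl : IsLocalHomeomorph f := IsLocalHomeomorph.of_comp (hcomp ▸ hexp) hq hfc
  exact ⟨(Equiv.ofBijective f ⟨hfi, hfs⟩).toHomeomorphOfContinuousOpen hfc hfl.isOpenMap,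
    fun z => hF.apply_eq z z.2⟩

end IsExpLift

end ExpLift

/-! ### Local behaviour of meromorphic functions -/

/-- A locally injective holomorphic function has no critical point. -/
theorem deriv_ne_zero_of_injOn {g : ℂ → ℂ} {w : ℂ} (hg : AnalyticAt ℂ g w) {s : Set ℂ}
    (hs : s ∈ 𝓝 w) (hinj : InjOn g s) : deriv g w ≠ 0 := by
  have hev : ∀ᶠ z in 𝓝 w, AnalyticAt ℂ g z := hg.eventually_analyticAt
  -- Zeros of the derivative are isolated; otherwise the function is locally constant, against
  -- injectivity.
  have hne : ∀ᶠ z in 𝓝 w, z ≠ w → deriv g z ≠ 0 := by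
    rcases hg.deriv.eventually_eq_or_eventually_ne (analyticAt_const (v := (0 : ℂ))) with h | h
    · exfalso
      obtain ⟨ε, hε, hεs⟩ := Metric.mem_nhds_iff.1 (inter_mem hs (hev.and h))
      have hconst : ∀ z ∈ Metric.ball w ε, g z = g w := fun z hz =>
        Metric.isOpen_ball.is_const_of_deriv_eq_zero (convex_ball w ε).isPreconnected
          (fun v hv => (hεs hv).2.1.differentiableAt.differentiableWithinAt)
          (fun v hv => (hεs hv).2.2) hz (Metric.mem_ball_self hε)
      have hmem : w + ((ε / 2 : ℝ) : ℂ) ∈ Metric.ball w ε := by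
        rw [mem_ball_iff_norm, add_sub_cancel_left, Complex.norm_real,
          Real.norm_of_nonneg (by positivity)]
        linarith
      have := hinj (hεs hmem).1 (mem_of_mem_nhds hs) (hconst _ hmem)
      have h0 : ((ε / 2 : ℝ) : ℂ) = 0 := by simpa using this
      have h1 : ε / 2 = 0 := by exact_mod_cast h0
      linarith
    · exact eventually_nhdsWithin_iff.1 h
  obtain ⟨ε, hε, hεs⟩ := Metric.mem_nhds_iff.1 (inter_mem hs (hev.and hne))
  have hwB : w ∈ Metric.ball w ε := Metric.mem_ball_self hε
  have hinjB : InjOn g (Metric.ball w ε) := hinj.mono fun z hz => (hεs hz).1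
  have han : AnalyticOnNhd ℂ g (Metric.ball w ε) := fun z hz => (hεs hz).2.1
  have hopen : ∀ t ⊆ Metric.ball w ε, IsOpen t → IsOpen (g '' t) := by
    rcases han.is_constant_or_isOpen (convex_ball w ε).isPreconnected with ⟨c, hc⟩ | h
    · exfalso
      have hmem : w + ((ε / 2 : ℝ) : ℂ) ∈ Metric.ball w ε := by
        rw [mem_ball_iff_norm, add_sub_cancel_left, Complex.norm_real,
          Real.norm_of_nonneg (by positivity)]
        linarith
      have := hinjB hmem hwB ((hc _ hmem).trans (hc _ hwB).symm)
      have h0 : ((ε / 2 : ℝ) : ℂ) = 0 := by simpa using this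
      have h1 : ε / 2 = 0 := by exact_mod_cast h0
      linarith
    · exact h
  let φ : OpenPartialHomeomorph ℂ ℂ := OpenPartialHomeomorph.ofContinuousOpenRestrict
    (hinjB.toPartialEquiv g (Metric.ball w ε)) han.continuousOn
    (by
      intro t ht
      have h1 : IsOpen ((↑) '' t : Set ℂ) := Metric.isOpen_ball.isOpenMap_subtype_val t ht
      have h2 := hopen _ (by rintro _ ⟨z, -, rfl⟩; exact z.2) h1
      rw [image_image] at h2
      exact h2) Metric.isOpen_ball
  have hφw : g w ∈ φ.target := φ.map_source hwB
  -- The inverse is holomorphic off `g w` and continuous there, so the singularity is removable; the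
  -- chain rule for `φ.symm ∘ g = id` then excludes a zero derivative.
  have hdiff : DifferentiableOn ℂ φ.symm φ.target := by
    refine (Complex.differentiableOn_compl_singleton_and_continuousAt_iff
      (φ.open_target.mem_nhds hφw)).1 ⟨fun v hv => ?_, φ.continuousAt_symm hφw⟩
    have hsrc : φ.symm v ∈ Metric.ball w ε := φ.map_target hv.1
    have hvw : φ.symm v ≠ w := fun h => hv.2 (by
      rw [mem_singleton_iff, ← φ.right_inv hv.1, h]; rfl)
    exact (φ.hasDerivAt_symm hv.1 ((hεs hsrc).2.2 hvw)
      (hεs hsrc).2.1.differentiableAt.hasDerivAt).differentiableAt.differentiableWithinAt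
  have h1 : HasDerivAt φ.symm (deriv φ.symm (g w)) (g w) :=
    (hdiff.differentiableAt (φ.open_target.mem_nhds hφw)).hasDerivAt
  have h2 : HasDerivAt (φ.symm ∘ g) (deriv φ.symm (g w) * deriv g w) w :=
    h1.comp w hg.differentiableAt.hasDerivAt
  have h3 : HasDerivAt (φ.symm ∘ g) 1 w := by
    refine (hasDerivAt_id w).congr_of_eventuallyEq ?_
    filter_upwards [Metric.ball_mem_nhds w hε] with z hz
    exact φ.left_inv hz
  intro h0
  have := h2.unique h3
  simp [h0] at this

section LocalExpr

variable {M : Type*} [TopologicalSpace M] [ChartedSpace ℂ M] {Ψ : M → OnePoint ℂ} {p : M}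

theorem IsLocalExpr.exists_isOpenEmbedding {g : ℂ → ℂ} (h : IsLocalExpr Ψ p g) :
    ∃ c : ℂ → OnePoint ℂ, IsOpenEmbedding c ∧ ∀ᶠ x in 𝓝 p, Ψ x = c (g (chartAt ℂ p x)) := by
  rcases h.2 with h | h
  · exact ⟨_, OnePoint.isOpenEmbedding_coe, h⟩
  · exact ⟨_, isOpenEmbedding_recip, h⟩

theorem continuousAt_chartAt (p : M) : ContinuousAt (chartAt ℂ p) p :=
  (chartAt ℂ p).continuousAt (mem_chart_source ℂ p)

theorem IsMeromorphicAt.continuousAt (h : IsMeromorphicAt Ψ p) : ContinuousAt Ψ p := by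
  obtain ⟨g, hg⟩ := h
  obtain ⟨c, hc, hev⟩ := hg.exists_isOpenEmbedding
  have h1 : ContinuousAt (fun x => c (g (chartAt ℂ p x))) p :=
    hc.continuous.continuousAt.comp (hg.1.continuousAt.comp (continuousAt_chartAt p))
  exact h1.congr (hev.mono fun x hx => hx.symm)

theorem tendsto_chartAt_nhdsNE (p : M) :
    Tendsto (chartAt ℂ p) (𝓝[≠] p) (𝓝[≠] (chartAt ℂ p p)) := by
  refine tendsto_nhdsWithin_iff.2
    ⟨(continuousAt_chartAt p).tendsto.mono_left nhdsWithin_le_nhds, ?_⟩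
  filter_upwards [self_mem_nhdsWithin, nhdsWithin_le_nhds ((chartAt ℂ p).open_source.mem_nhds
    (mem_chart_source ℂ p))] with x hx hxs h
  exact hx ((chartAt ℂ p).injOn hxs (mem_chart_source ℂ p) h)

/-- The fibre of a meromorphic function is either a neighbourhood of a given point of it, or
discrete there. -/
theorem IsMeromorphicAt.eventually_eq_or_eventually_ne (h : IsMeromorphicAt Ψ p) :
    (∀ᶠ x in 𝓝 p, Ψ x = Ψ p) ∨ ∀ᶠ x in 𝓝[≠] p, Ψ x ≠ Ψ p := by
  obtain ⟨g, hg⟩ := h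
  obtain ⟨c, hc, hev⟩ := hg.exists_isOpenEmbedding
  have hp := hev.self_of_nhds
  rcases hg.1.eventually_eq_or_eventually_ne
    (analyticAt_const (v := g (chartAt ℂ p p))) with h | h
  · left
    filter_upwards [hev, (continuousAt_chartAt p).eventually h] with x hx hx'
    rw [hx, hp, hx']
  · right
    filter_upwards [nhdsWithin_le_nhds hev, (tendsto_chartAt_nhdsNE p).eventually h] with x hx hx'
    rw [hx, hp]
    exact fun h => hx' (hc.injective h)

/-- A meromorphic function is a local homeomorphism at points that are not critical. -/
theorem IsMeromorphicAt.exists_openPartialHomeomorph (h : IsMeromorphicAt Ψ p)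
    (hp : ¬ IsCriticalPoint Ψ p) :
    ∃ φ : OpenPartialHomeomorph M (OnePoint ℂ), p ∈ φ.source ∧ EqOn Ψ φ φ.source := by
  obtain ⟨g, hg⟩ := h
  have hd : deriv g (chartAt ℂ p p) ≠ 0 := fun h0 => hp ⟨g, hg, h0⟩
  obtain ⟨c, hc, hev⟩ := hg.exists_isOpenEmbedding
  obtain ⟨W, hW, hWo, hpW⟩ := eventually_nhds_iff.1 hev
  have hstrict := hg.1.hasStrictDerivAt.hasStrictFDerivAt_equiv hd
  let φ := (((chartAt ℂ p).trans hstrict.toOpenPartialHomeomorph).trans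
    (hc.toOpenPartialHomeomorph c)).restrOpen W hWo
  refine ⟨φ, ?_, fun x hx => ?_⟩
  · simp [φ, hpW, hstrict.mem_toOpenPartialHomeomorph_source]
  · exact hW x hx.2

theorem IsLocalExpr.deriv_ne_zero_of_injOn {g : ℂ → ℂ} (h : IsLocalExpr Ψ p g) {N : Set M}
    (hN : N ∈ 𝓝 p) (hinj : InjOn Ψ N) : deriv g (chartAt ℂ p p) ≠ 0 := by
  obtain ⟨c, -, hev⟩ := h.exists_isOpenEmbedding
  have hp := mem_chart_target ℂ p
  have hsymm : Tendsto (chartAt ℂ p).symm (𝓝 (chartAt ℂ p p)) (𝓝 p) := by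
    have := (chartAt ℂ p).continuousAt_symm hp
    rwa [ContinuousAt, (chartAt ℂ p).left_inv (mem_chart_source ℂ p)] at this
  refine InverseSingularity.deriv_ne_zero_of_injOn h.1 (inter_mem
    ((chartAt ℂ p).open_target.mem_nhds hp) (hsymm (inter_mem hN hev))) ?_
  rintro v ⟨hv, hvN, hvΨ⟩ w ⟨hw, hwN, hwΨ⟩ hvw
  refine (chartAt ℂ p).symm.injOn hv hw (hinj hvN hwN ?_)
  have e1 : Ψ ((chartAt ℂ p).symm v) = c (g (chartAt ℂ p ((chartAt ℂ p).symm v))) := hvΨ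
  have e2 : Ψ ((chartAt ℂ p).symm w) = c (g (chartAt ℂ p ((chartAt ℂ p).symm w))) := hwΨ
  rw [e1, e2, (chartAt ℂ p).right_inv hv, (chartAt ℂ p).right_inv hw, hvw]

/-- A meromorphic function is not injective near a critical point. -/
theorem not_isCriticalPoint_of_injOn {N : Set M} (hN : N ∈ 𝓝 p) (hinj : InjOn Ψ N) :
    ¬ IsCriticalPoint Ψ p := fun ⟨_, hg, h0⟩ => hg.deriv_ne_zero_of_injOn hN hinj h0

end LocalExpr

/-! ### Components of preimages of disks. -/

section Component

variable {M : Type*} {Ψ : M → OnePoint ℂ} {e p : M}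

theorem mem_diskPreimage_self (hp : p ≠ e) {ρ : ℝ} (hρ : 0 < ρ) :
    p ∈ diskPreimage Ψ e (Ψ p) ρ :=
  ⟨hp, mem_sphericalDisk_self _ hρ⟩

theorem diskPreimage_mono (Ψ : M → OnePoint ℂ) (e : M) (a : OnePoint ℂ) :
    Monotone (diskPreimage Ψ e a) :=
  fun _ _ h _ hx => ⟨hx.1, sphericalDisk_mono a h hx.2⟩

theorem isOpen_diskPreimage [TopologicalSpace M] [T1Space M]
    (hΨ : ∀ x, x ≠ e → ContinuousAt Ψ x) (a : OnePoint ℂ) {ρ : ℝ} (hρ : 0 < ρ) : IsOpen (diskPreimage Ψ e a ρ) := by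
  rw [isOpen_iff_mem_nhds]
  rintro x ⟨hx, hxD⟩
  filter_upwards [isOpen_ne.mem_nhds hx,
    (hΨ x hx).eventually ((isOpen_sphericalDisk a hρ).mem_nhds hxD)] with y h1 h2
  exact ⟨h1, h2⟩

/-- If the fibre through `p` is discrete at `p`, the components at `p` of the preimages of small
disks shrink to `p`. -/
theorem exists_component_subset [TopologicalSpace M] [T2Space M] [LocallyCompactSpace M]
    (hΨ : ∀ x, x ≠ e → ContinuousAt Ψ x) (hp : p ≠ e) (hiso : ∀ᶠ x in 𝓝[≠] p, Ψ x ≠ Ψ p)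
    {N : Set M} (hN : N ∈ 𝓝 p) :
    ∃ ρ > 0, connectedComponentIn (diskPreimage Ψ e (Ψ p) ρ) p ⊆ N := by
  have hN' : N ∩ {x | x ≠ e ∧ (x ≠ p → Ψ x ≠ Ψ p)} ∈ 𝓝 p :=
    inter_mem hN ((isOpen_ne.eventually_mem hp).and (eventually_nhdsWithin_iff.1 hiso))
  obtain ⟨W, hWN, hWo, hpW⟩ := mem_nhds_iff.1 hN'
  obtain ⟨V, hVo, hpV, hVW, hVc⟩ := exists_open_between_and_isCompact_closure isCompact_singleton
    hWo (singleton_subset_iff.2 hpW)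
  have hpV : p ∈ V := singleton_subset_iff.1 hpV
  have hfr : IsCompact (frontier V) :=
    hVc.of_isClosed_subset isClosed_frontier frontier_subset_closure
  have himg : IsCompact (Ψ '' frontier V) := hfr.image_of_continuousOn fun x hx =>
    (hΨ x (hWN (hVW (frontier_subset_closure hx))).2.1).continuousWithinAt
  have hnot : Ψ p ∉ Ψ '' frontier V := by
    rintro ⟨x, hx, hxp⟩
    refine (hWN (hVW (frontier_subset_closure hx))).2.2 ?_ hxp
    rintro rfl
    rw [hVo.frontier_eq] at hx
    exact hx.2 hpV
  -- The disk is chosen to miss the compact image of the frontier of `V`, so the component at `p`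
  -- cannot leave `V`.
  obtain ⟨ρ, hρ, -, -, hsub⟩ :=
    exists_sphericalDisk_subset (himg.isClosed.isOpen_compl.mem_nhds hnot) one_pos
  refine ⟨ρ, hρ, Subset.trans ?_ (subset_closure.trans (hVW.trans fun x hx => (hWN hx).1))⟩
  refine isPreconnected_connectedComponentIn.subset_of_closure_inter_subset hVo
    ⟨p, mem_connectedComponentIn (mem_diskPreimage_self hp hρ), hpV⟩ ?_
  rintro x ⟨hx, hxT⟩
  by_contra hxV
  exact hsub (connectedComponentIn_subset _ _ hxT).2
    ⟨x, by rw [hVo.frontier_eq]; exact ⟨hx, hxV⟩, rfl⟩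

end Component

/-! ### Branches of the inverse function -/

namespace Branch

section

variable {M : Type*} [TopologicalSpace M] {Ψ : M → OnePoint ℂ} {e : M} (U V : Branch Ψ e)
  {ρ ρ' : Ioi (0 : ℝ)}

theorem nbhd_nonempty (ρ : Ioi (0 : ℝ)) : (U.nbhd ρ).Nonempty := by
  obtain ⟨z, hz, h⟩ := U.isComponent ρ
  exact ⟨z, h ▸ mem_connectedComponentIn hz⟩

theorem nbhd_subset (ρ : Ioi (0 : ℝ)) : U.nbhd ρ ⊆ diskPreimage Ψ e U.value ρ := by
  obtain ⟨z, hz, h⟩ := U.isComponent ρ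
  exact h ▸ connectedComponentIn_subset _ _

theorem isPreconnected_nbhd (ρ : Ioi (0 : ℝ)) : IsPreconnected (U.nbhd ρ) := by
  obtain ⟨z, hz, h⟩ := U.isComponent ρ
  exact h ▸ isPreconnected_connectedComponentIn

theorem nbhd_eq {z : M} (hz : z ∈ U.nbhd ρ) :
    U.nbhd ρ = connectedComponentIn (diskPreimage Ψ e U.value ρ) z := by
  obtain ⟨w, hw, h⟩ := U.isComponent ρ
  rw [h] at hz ⊢
  exact connectedComponentIn_eq hz

theorem subset_nbhd {A : Set M} (hA : IsPreconnected A) (hsub : A ⊆ diskPreimage Ψ e U.value ρ)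
    (h : (A ∩ U.nbhd ρ).Nonempty) : A ⊆ U.nbhd ρ := by
  obtain ⟨z, hzA, hz⟩ := h
  rw [U.nbhd_eq hz]
  exact hA.subset_connectedComponentIn hzA hsub

theorem nbhd_subset_nbhd (hD : sphericalDisk V.value ρ' ⊆ sphericalDisk U.value ρ)
    (h : (V.nbhd ρ' ∩ U.nbhd ρ).Nonempty) : V.nbhd ρ' ⊆ U.nbhd ρ :=
  U.subset_nbhd (V.isPreconnected_nbhd ρ')
    (fun _ hx => ⟨(V.nbhd_subset ρ' hx).1, hD (V.nbhd_subset ρ' hx).2⟩) h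

theorem isOpen_nbhd [LocallyConnectedSpace M] [T1Space M] (hΨ : ∀ x, x ≠ e → ContinuousAt Ψ x)
    (ρ : Ioi (0 : ℝ)) : IsOpen (U.nbhd ρ) := by
  obtain ⟨z, hz, h⟩ := U.isComponent ρ
  exact h ▸ (isOpen_diskPreimage hΨ _ ρ.2).connectedComponentIn

/-- Components of an open set in a locally connected space are open, hence relatively closed. -/
theorem mem_nbhd_of_mem_closure [LocallyConnectedSpace M] [T1Space M]
    (hΨ : ∀ x, x ≠ e → ContinuousAt Ψ x) {x : M} (hx : x ∈ closure (U.nbhd ρ))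
    (hxD : x ∈ diskPreimage Ψ e U.value ρ) : x ∈ U.nbhd ρ := by
  have hopen := (isOpen_diskPreimage hΨ U.value ρ.2).connectedComponentIn (x := x)
  refine U.subset_nbhd isPreconnected_connectedComponentIn (connectedComponentIn_subset _ _) ?_
    (mem_connectedComponentIn hxD)
  exact mem_closure_iff.1 hx _ hopen (mem_connectedComponentIn hxD)

variable {U V} in
/-- Two branches over the same value with meeting small neighbourhoods coincide. -/
theorem eq_of_forall_meet (hv : V.value = U.value)
    (h : ∀ ρ : Ioi (0 : ℝ), ∃ ρ' ≤ ρ, (V.nbhd ρ' ∩ U.nbhd ρ').Nonempty) : V = U := by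
  refine Branch.ext hv (funext fun ρ => ?_)
  obtain ⟨ρ', hle, z, hzV, hzU⟩ := h ρ
  rw [V.nbhd_eq (V.mono hle hzV), U.nbhd_eq (U.mono hle hzU), hv]

/-- The branch through a point. -/
def ofPoint (Ψ : M → OnePoint ℂ) {p : M} (hp : p ≠ e) : Branch Ψ e where
  value := Ψ p
  nbhd ρ := connectedComponentIn (diskPreimage Ψ e (Ψ p) ρ) p
  isComponent ρ := ⟨p, mem_diskPreimage_self hp ρ.2, rfl⟩
  mono _ _ h := connectedComponentIn_mono _ (diskPreimage_mono Ψ e _ h)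

theorem mem_nbhd_ofPoint {p : M} (hp : p ≠ e) (ρ : Ioi (0 : ℝ)) : p ∈ (ofPoint Ψ hp).nbhd ρ :=
  mem_connectedComponentIn (mem_diskPreimage_self hp ρ.2)

/-- The branch defined by the end of a curve along which `Ψ` converges. -/
theorem exists_branch_of_tendsto {c : ℝ → M} {t : ℝ} (ht : 0 < t) (hc : ContinuousOn c (Ico 0 t))
    (hce : ∀ s ∈ Ico 0 t, c s ≠ e) {b : OnePoint ℂ} (hb : Tendsto (Ψ ∘ c) (𝓝[<] t) (𝓝 b)) :
    ∃ V : Branch Ψ e, V.value = b ∧ ∀ ρ, ∀ᶠ s in 𝓝[<] t, c s ∈ V.nbhd ρ := by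
  have hex : ∀ ρ : Ioi (0 : ℝ), ∃ T ∈ Ico 0 t, ∀ s ∈ Ico T t, c s ∈ diskPreimage Ψ e b ρ := by
    intro ρ
    have h1 : ∀ᶠ s in 𝓝[<] t, Ψ (c s) ∈ sphericalDisk b ρ := hb (sphericalDisk_mem_nhds b ρ.2)
    obtain ⟨l, hl, hls⟩ := mem_nhdsLT_iff_exists_Ico_subset.1 h1
    have hl' : l < t := hl
    refine ⟨max l 0, ⟨le_max_right _ _, max_lt hl' ht⟩,
      fun s hs => ⟨hce s ⟨?_, hs.2⟩, hls ⟨?_, hs.2⟩⟩⟩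
    · exact (le_max_right _ _).trans hs.1
    · exact (le_max_left _ _).trans hs.1
  choose T hT hTs using hex
  have hmem : ∀ ρ, ∀ s ∈ Ico (T ρ) t,
      c s ∈ connectedComponentIn (diskPreimage Ψ e b ρ) (c (T ρ)) := by
    intro ρ s hs
    have hpre : IsPreconnected (c '' Ico (T ρ) t) :=
      isPreconnected_Ico.image _ (hc.mono (Ico_subset_Ico_left (hT ρ).1))
    exact hpre.subset_connectedComponentIn ⟨T ρ, left_mem_Ico.2 (hT ρ).2, rfl⟩
      (by rintro _ ⟨u, hu, rfl⟩; exact hTs ρ u hu) ⟨s, hs, rfl⟩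
  refine ⟨⟨b, fun ρ => connectedComponentIn (diskPreimage Ψ e b ρ) (c (T ρ)),
    fun ρ => ⟨c (T ρ), hTs ρ _ (left_mem_Ico.2 (hT ρ).2), rfl⟩, fun ρ ρ' h => ?_⟩, rfl,
    fun ρ => ?_⟩
  · have hu : max (T ρ) (T ρ') < t := max_lt (hT ρ).2 (hT ρ').2
    have h1 := hmem ρ (max (T ρ) (T ρ')) ⟨le_max_left _ _, hu⟩
    have h2 := hmem ρ' (max (T ρ) (T ρ')) ⟨le_max_right _ _, hu⟩
    beta_reduce
    rw [connectedComponentIn_eq h1, connectedComponentIn_eq h2]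
    exact connectedComponentIn_mono _ (diskPreimage_mono Ψ e b h)
  · exact mem_of_superset (Ico_mem_nhdsLT (hT ρ).2) (hmem ρ)

variable {U}

/-- `Ψ` attains other values than `a` in every neighbourhood of a transcendental singularity. -/
theorem IsTranscendental.exists_ne (hU : U.IsTranscendental) (ρ : Ioi (0 : ℝ)) :
    ∃ x ∈ U.nbhd ρ, Ψ x ≠ U.value := by
  by_contra! h
  obtain ⟨x, hx⟩ := U.nbhd_nonempty ρ
  -- If `Ψ` were constantly `a` on `U_a(ρ)`, this set would lie over every disk around `a`, hence in
  -- every `U_a(ρ')`.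
  have hmem : x ∈ ⋂ ρ, U.nbhd ρ := by
    refine mem_iInter.2 fun ρ' => ?_
    rcases le_total ρ ρ' with hle | hle
    · exact U.mono hle hx
    · refine U.subset_nbhd (U.isPreconnected_nbhd ρ)
        (fun y hy => ⟨(U.nbhd_subset ρ hy).1, ?_⟩) ?_ hx
      · rw [h y hy]
        exact mem_sphericalDisk_self _ ρ'.2
      · obtain ⟨y, hy⟩ := U.nbhd_nonempty ρ'
        exact ⟨y, U.mono hle hy, hy⟩
  rw [show (⋂ ρ, U.nbhd ρ) = ∅ from hU] at hmem
  exact hmem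

theorem eq_value_of_forall_mem {x : M} (h : ∀ ρ, x ∈ U.nbhd ρ) : Ψ x = U.value :=
  eq_of_forall_mem_sphericalDisk fun ρ hρ => (U.nbhd_subset ⟨ρ, hρ⟩ (h ⟨ρ, hρ⟩)).2

/-- The fibres of `Ψ` are discrete in the neighbourhoods of a transcendental singularity. -/
theorem IsTranscendental.eventually_ne [ChartedSpace ℂ M] [T2Space M]
    (hΨ : ∀ p, p ≠ e → IsMeromorphicAt Ψ p)
    (hU : U.IsTranscendental) {x : M} (hx : x ∈ U.nbhd ρ) : ∀ᶠ y in 𝓝[≠] x, Ψ y ≠ Ψ x := by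
  have hxe := (U.nbhd_subset ρ hx).1
  rcases (hΨ x hxe).eventually_eq_or_eventually_ne with h | h
  swap
  · exact h
  exfalso
  -- Identity theorem: the set where `Ψ` is locally constant with value `Ψ x` is open, and closed
  -- relative to `U_a(ρ)`.
  let Z : Set M := {y | ∀ᶠ z in 𝓝 y, Ψ z = Ψ x}
  have hZo : IsOpen Z := isOpen_setOfPred_eventually_nhds
  have hsub : U.nbhd ρ ⊆ Z := by
    refine (U.isPreconnected_nbhd ρ).subset_of_closure_inter_subset hZo ⟨x, hx, h⟩ ?_
    rintro y ⟨hyZ, hyU⟩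
    have hm := hΨ y (U.nbhd_subset ρ hyU).1
    have hyx : Ψ y = Ψ x := by
      by_contra hne
      obtain ⟨z, hz1, hz2⟩ := mem_closure_iff_nhds.1 hyZ _
        (hm.continuousAt (isOpen_ne.mem_nhds hne))
      exact hz1 (show ∀ᶠ z in 𝓝 z, Ψ z = Ψ x from hz2).self_of_nhds
    rcases hm.eventually_eq_or_eventually_ne with h' | h'
    · exact h'.mono fun z hz => hz.trans hyx
    · by_contra hy
      obtain ⟨z, hz1, hz2⟩ := mem_closure_iff_nhds.1 hyZ _ (eventually_nhdsWithin_iff.1 h')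
      have hzy : z ≠ y := fun h => hy (h ▸ hz2)
      exact hz1 hzy ((show ∀ᶠ z in 𝓝 z, Ψ z = Ψ x from hz2).self_of_nhds.trans hyx.symm)
  have hconst : ∀ y ∈ U.nbhd ρ, Ψ y = Ψ x := fun y hy =>
    (show ∀ᶠ z in 𝓝 y, Ψ z = Ψ x from hsub hy).self_of_nhds
  have hxa : Ψ x = U.value := by
    refine eq_of_forall_mem_sphericalDisk fun ρ' hρ' => ?_
    obtain ⟨y, hy⟩ := U.nbhd_nonempty (min ρ ⟨ρ', hρ'⟩)
    rw [← hconst y (U.mono (min_le_left _ _) hy)]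
    exact (U.nbhd_subset ⟨ρ', hρ'⟩ (U.mono (min_le_right _ _) hy)).2
  obtain ⟨y, hy, hya⟩ := hU.exists_ne ρ
  exact hya ((hconst y hy).trans hxa)

end

/-! ### Consequences of separation. -/

section Separate

variable {M : Type*} [TopologicalSpace M] [T2Space M] [ChartedSpace ℂ M] {Ψ : M → OnePoint ℂ}
  {e : M} {U : Branch Ψ e} {ρ : Ioi (0 : ℝ)}

/-- The critical points in a separating neighbourhood would give algebraic singularities. -/
theorem IsTranscendental.not_isCriticalPoint (hΨ : ∀ p, p ≠ e → IsMeromorphicAt Ψ p)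
    (hU : U.IsTranscendental)
    (hsep : ∀ V : Branch Ψ e, V.IsSingularity → V ≠ U → ∃ ρ₂, Disjoint (U.nbhd ρ) (V.nbhd ρ₂))
    {x : M} (hx : x ∈ U.nbhd ρ) : ¬ IsCriticalPoint Ψ x := by
  intro hcrit
  have : LocallyCompactSpace M := ChartedSpace.locallyCompactSpace ℂ M
  have hxe := (U.nbhd_subset ρ hx).1
  -- Discreteness of the fibre shrinks the branch through `x` to `x`, making it an algebraic
  -- singularity.
  have hinter : (⋂ ρ, (ofPoint Ψ hxe).nbhd ρ) = {x} := by
    refine Subset.antisymm (fun y hy => ?_) (singleton_subset_iff.2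
      (mem_iInter.2 (mem_nbhd_ofPoint hxe)))
    by_contra hne
    obtain ⟨ρ', hρ', hsub⟩ := exists_component_subset (fun p hp => (hΨ p hp).continuousAt) hxe
      (hU.eventually_ne hΨ hx) (isOpen_ne.mem_nhds (Ne.symm hne))
    exact hsub (mem_iInter.1 hy ⟨ρ', hρ'⟩) rfl
  obtain ⟨ρ₂, hdisj⟩ := hsep (ofPoint Ψ hxe) (Or.inl ⟨x, hinter, hcrit⟩) fun h => by
    rw [h, show (⋂ ρ, U.nbhd ρ) = ∅ from hU] at hinter
    exact (singleton_nonempty x).ne_empty hinter.symm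
  exact disjoint_left.1 hdisj hx (mem_nbhd_ofPoint hxe ρ₂)

/-- Curves in a separating neighbourhood along which `Ψ` converges to a point of the punctured
disk converge. -/
theorem IsTranscendental.exists_tendsto (hΨ : ∀ p, p ≠ e → IsMeromorphicAt Ψ p)
    (hU : U.IsTranscendental)
    (hsep : ∀ V : Branch Ψ e, V.IsSingularity → V ≠ U → ∃ ρ₂, Disjoint (U.nbhd ρ) (V.nbhd ρ₂))
    {c : ℝ → M} {t : ℝ} (ht : 0 < t) (hc : ContinuousOn c (Ico 0 t))
    (hcU : ∀ s ∈ Ico 0 t, c s ∈ U.nbhd ρ) {b : OnePoint ℂ} (hbD : b ∈ sphericalDisk U.value ρ)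
    (hba : b ≠ U.value) (hb : Tendsto (Ψ ∘ c) (𝓝[<] t) (𝓝 b)) :
    ∃ x ∈ U.nbhd ρ, Tendsto c (𝓝[<] t) (𝓝 x) := by
  have : LocallyCompactSpace M := ChartedSpace.locallyCompactSpace ℂ M
  obtain ⟨V, rfl, hV⟩ := exists_branch_of_tendsto ht hc
    (fun s hs => (U.nbhd_subset ρ (hcU s hs)).1) hb
  have hmeet : ∀ ρ₂, (V.nbhd ρ₂ ∩ U.nbhd ρ).Nonempty := fun ρ₂ => by
    obtain ⟨s, hs, hsI⟩ := ((hV ρ₂).and (Ico_mem_nhdsLT ht)).exists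
    exact ⟨c s, hs, hcU s hsI⟩
  -- A singular `V` would be separated from `U_a(ρ)`; it differs from `U` because it lies over
  -- another value.
  have hns : ¬ V.IsSingularity := fun h => by
    obtain ⟨ρ₂, hdisj⟩ := hsep V h fun h => hba (h ▸ rfl)
    obtain ⟨z, hzV, hzU⟩ := hmeet ρ₂
    exact disjoint_left.1 hdisj hzU hzV
  obtain ⟨x, hx⟩ : (⋂ ρ, V.nbhd ρ).Nonempty :=
    nonempty_iff_ne_empty.2 fun h => hns (Or.inr h)
  rw [mem_iInter] at hx
  have hxV : Ψ x = V.value := eq_value_of_forall_mem hx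
  obtain ⟨ρ', hρ', -, -, hsub⟩ :=
    exists_sphericalDisk_subset ((isOpen_sphericalDisk U.value ρ.2).mem_nhds hbD) one_pos
  have hxU : x ∈ U.nbhd ρ := U.nbhd_subset_nbhd V (ρ' := ⟨ρ', hρ'⟩) hsub (hmeet _) (hx _)
  refine ⟨x, hxU, fun N hN => ?_⟩
  obtain ⟨ρ₂, hρ₂, hsub⟩ := exists_component_subset (fun p hp => (hΨ p hp).continuousAt)
    (U.nbhd_subset ρ hxU).1 (hU.eventually_ne hΨ hxU) hN
  have heq := V.nbhd_eq (hx ⟨ρ₂, hρ₂⟩)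
  rw [← hxV] at heq
  filter_upwards [hV ⟨ρ₂, hρ₂⟩] with s hs
  rw [heq] at hs
  exact hsub hs

end Separate

/-! ### The coordinate on a neighbourhood of a singularity -/

section Coordinate

variable {M : Type*} [TopologicalSpace M] {Ψ : M → OnePoint ℂ} {e : M} (U : Branch Ψ e)
  {ρ : Ioi (0 : ℝ)}

/-- `q` is the map `Ψ` on the neighbourhood `U_a(ρ)`, read in the chart of the sphere at `a`. -/
def IsCoordinate (ρ : Ioi (0 : ℝ)) (q : U.nbhd ρ → ℂ) : Prop :=
  ∀ x, sphereChart U.value (q x) = Ψ x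

theorem exists_isCoordinate (hρ : (ρ : ℝ) ≤ Real.pi) : ∃ q, U.IsCoordinate ρ q := by
  have : ∀ x : U.nbhd ρ, ∃ w, sphereChart U.value w = Ψ x := fun x =>
    sphericalDisk_subset_range hρ (U.nbhd_subset ρ x.2).2
  choose q hq using this
  exact ⟨q, hq⟩

namespace IsCoordinate

variable {U} {q : U.nbhd ρ → ℂ} (hq : U.IsCoordinate ρ q)
include hq

theorem eq_zero_iff {x : U.nbhd ρ} : q x = 0 ↔ Ψ x = U.value := by
  rw [← hq x]
  constructor
  · intro h
    rw [h, sphereChart_zero]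
  · intro h
    exact (isOpenEmbedding_sphereChart U.value).injective (h.trans (sphereChart_zero _).symm)

theorem norm_lt_iff {x : U.nbhd ρ} {ρ' : ℝ} (h0 : 0 < ρ') (hρ' : ρ' < Real.pi) :
    ‖q x‖ < flatRadius ρ' ↔ Ψ x ∈ sphericalDisk U.value ρ' := by
  rw [← hq x, sphereChart_mem_disk h0 hρ']

theorem mem_ball (hρ : (ρ : ℝ) < Real.pi) (x : U.nbhd ρ) :
    q x ∈ Metric.ball 0 (flatRadius ρ) := by
  rw [mem_ball_zero_iff, hq.norm_lt_iff ρ.2 hρ]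
  exact (U.nbhd_subset ρ x.2).2

theorem isLocalHomeomorph (h : IsLocalHomeomorph fun x : U.nbhd ρ => Ψ x) :
    IsLocalHomeomorph q := by
  have hcomp : sphereChart U.value ∘ q = fun x : U.nbhd ρ => Ψ x := funext hq
  have hemb := isOpenEmbedding_sphereChart U.value
  refine IsLocalHomeomorph.of_comp (hcomp ▸ h) hemb.isLocalHomeomorph ?_
  rw [hemb.isInducing.continuous_iff, hcomp]
  exact h.continuous

end IsCoordinate

end Coordinate

end Branch

theorem exists_flatRadius_le {ε : ℝ} (hε : 0 < ε) {r : ℝ} (hr : 0 < r) :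
    ∃ ρ, 0 < ρ ∧ ρ < r ∧ ρ < Real.pi ∧ flatRadius ρ ≤ ε := by
  have harc : 0 < Real.arctan ε := Real.arctan_pos.2 hε
  have hlt := Real.arctan_lt_pi_div_two ε
  have h0 : 0 < min (2 * Real.arctan ε) r / 2 := by positivity
  have h1 := min_le_left (2 * Real.arctan ε) r
  have h2 := min_le_right (2 * Real.arctan ε) r
  refine ⟨min (2 * Real.arctan ε) r / 2, h0, by linarith, by linarith, ?_⟩
  have := flatRadius_lt (ρ' := 2 * Real.arctan ε) h0 (by linarith) (by linarith)
  have h3 : flatRadius (2 * Real.arctan ε) = ε := by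
    rw [flatRadius, mul_div_cancel_left₀ _ two_ne_zero, Real.tan_arctan]
  linarith

/-- Every point has small punctured neighbourhoods that are connected. -/
theorem exists_preconnected_punctured_nhds {M : Type*} [TopologicalSpace M] [ChartedSpace ℂ M]
    {e : M} {W : Set M} (hW : W ∈ 𝓝 e) :
    ∃ P : Set M, IsPreconnected P ∧ e ∉ P ∧ P ⊆ W ∧ insert e P ∈ 𝓝 e := by
  set φ := chartAt ℂ e with hφ
  have hes : e ∈ φ.source := mem_chart_source ℂ e
  have het : φ e ∈ φ.target := mem_chart_target ℂ e
  have hsymm : Tendsto φ.symm (𝓝 (φ e)) (𝓝 e) := by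
    have := φ.continuousAt_symm het
    rwa [ContinuousAt, φ.left_inv hes] at this
  obtain ⟨ε, hε, hεs⟩ := Metric.mem_nhds_iff.1
    (inter_mem (φ.open_target.mem_nhds het) (hsymm hW))
  have hball : ∀ z ∈ Complex.exp ⁻¹' Metric.ball 0 ε, φ e + Complex.exp z ∈ Metric.ball (φ e) ε :=
    fun z hz => by simpa using hz
  -- The punctured chart disk is the image of a half-plane under `exp`, hence connected.
  refine ⟨(fun z => φ.symm (φ e + Complex.exp z)) '' (Complex.exp ⁻¹' Metric.ball 0 ε), ?_, ?_, ?_,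
    ?_⟩
  · refine (convex_exp_preimage_ball hε).isPreconnected.image _ ?_
    exact φ.continuousOn_symm.comp (by fun_prop) fun z hz => (hεs (hball z hz)).1
  · rintro ⟨z, hz, hze⟩
    have h1 := φ.right_inv (hεs (hball z hz)).1
    change φ.symm (φ e + Complex.exp z) = e at hze
    rw [hze] at h1
    exact Complex.exp_ne_zero z (left_eq_add.1 h1)
  · rintro _ ⟨z, hz, rfl⟩
    exact (hεs (hball z hz)).2
  · have hnhds : φ.source ∩ φ ⁻¹' Metric.ball (φ e) ε ∈ 𝓝 e :=
      inter_mem (φ.open_source.mem_nhds hes) (φ.continuousAt hes (Metric.ball_mem_nhds _ hε))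
    refine mem_of_superset hnhds ?_
    rintro x ⟨hxs, hxb⟩
    by_cases hxe : x = e
    · exact Or.inl hxe
    · right
      have hne : φ x - φ e ≠ 0 := sub_ne_zero.2 fun h => hxe (φ.injOn hxs hes h)
      refine ⟨Complex.log (φ x - φ e), ?_, ?_⟩
      · rw [mem_preimage, Complex.exp_log hne, mem_ball_zero_iff, ← mem_ball_iff_norm]
        exact hxb
      · simp only [Complex.exp_log hne, add_sub_cancel, φ.left_inv hxs]

/-! ### Separate singularities are logarithmic -/

namespace Branch

section

variable {M : Type*} [TopologicalSpace M] {Ψ : M → OnePoint ℂ} {e : M} {U : Branch Ψ e}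
  {ρ : Ioi (0 : ℝ)}

/-- If a neighbourhood of a transcendental singularity is uniformised by the exponential map,
then it contains no point over `a`. -/
theorem IsTranscendental.coordinate_ne_zero [T2Space M] (hU : U.IsTranscendental)
    (hρ : (ρ : ℝ) < Real.pi) {q : U.nbhd ρ → ℂ} (hq : U.IsCoordinate ρ q) (hql : IsLocalHomeomorph q)
    {F : ℂ → U.nbhd ρ} (hF : IsExpLift q (Metric.ball 0 (flatRadius ρ)) F) (y : U.nbhd ρ) : q y ≠ 0 := by
  intro hy
  have : PreconnectedSpace (U.nbhd ρ) :=
    isPreconnected_iff_preconnectedSpace.1 (U.isPreconnected_nbhd ρ)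
  have hr := flatRadius_pos ρ.2 hρ
  have hne : (Complex.exp ⁻¹' Metric.ball 0 (flatRadius ρ)).Nonempty := by
    rw [exp_preimage_ball hr]
    exact ⟨((Real.log (flatRadius ρ) - 1 : ℝ) : ℂ), by simp⟩
  obtain ⟨ε₀, hε₀, h⟩ := hF.exists_preconnected_of_eq_zero hql Metric.isOpen_ball
    (hq.mem_ball hρ) hne hy
  have hmem : (y : M) ∈ ⋂ ρ, U.nbhd ρ := by
    refine mem_iInter.2 fun ρ₂ => ?_
    obtain ⟨ρ', h0, hlt, hpi, hle⟩ := exists_flatRadius_le hε₀ (lt_min ρ.2 ρ₂.2)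
    have hρρ' : (⟨ρ', h0⟩ : Ioi (0 : ℝ)) ≤ ρ := (hlt.trans_le (min_le_left _ _)).le
    have hρ₂ρ' : (⟨ρ', h0⟩ : Ioi (0 : ℝ)) ≤ ρ₂ := (hlt.trans_le (min_le_right _ _)).le
    -- The sheet `N` of `y` contains every point with small nonzero coordinate, so it meets
    -- `U_a(ρ')` and therefore lies in it.
    obtain ⟨N, hN, hyN, hNq, hNmem⟩ := h (flatRadius ρ') (flatRadius_pos h0 hpi) hle
    refine U.mono hρ₂ρ' (U.subset_nbhd (A := (↑) '' N)
      (hN.image _ continuous_subtype_val.continuousOn) ?_ ?_ ⟨y, hyN, rfl⟩)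
    · rintro _ ⟨n, hn, rfl⟩
      exact ⟨(U.nbhd_subset ρ n.2).1, (hq.norm_lt_iff h0 hpi).1 (hNq n hn)⟩
    · obtain ⟨x, hx, hxa⟩ := hU.exists_ne ⟨ρ', h0⟩
      refine ⟨x, ⟨⟨x, U.mono hρρ' hx⟩, hNmem _ ?_ ?_, rfl⟩, hx⟩
      · rwa [Ne, hq.eq_zero_iff]
      · exact (hq.norm_lt_iff h0 hpi).2 (U.nbhd_subset _ hx).2
  rw [show (⋂ ρ, U.nbhd ρ) = ∅ from hU] at hmem
  exact hmem

/-- A neighbourhood that is uniformised by the exponential map is a universal covering of the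
punctured disk. -/
theorem IsCoordinate.exists_isCoveringMap (hρ : (ρ : ℝ) < Real.pi)
    {q : U.nbhd ρ → ℂ} (hq : U.IsCoordinate ρ q) (hq0 : ∀ x, q x ≠ 0)
    (Φ : (Complex.exp ⁻¹' Metric.ball 0 (flatRadius ρ)) ≃ₜ U.nbhd ρ)
    (hΦ : ∀ z, q (Φ z) = Complex.exp z) :
    ∃ h : MapsTo Ψ (U.nbhd ρ) (sphericalDisk U.value ρ \ {U.value}),
      IsCoveringMap h.restrict ∧ SimplyConnectedSpace (U.nbhd ρ) := by
  have hr := flatRadius_pos ρ.2 hρ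
  have hmaps : MapsTo Ψ (U.nbhd ρ) (sphericalDisk U.value ρ \ {U.value}) := fun x hx =>
    ⟨(U.nbhd_subset ρ hx).2, fun h => hq0 ⟨x, hx⟩ (hq.eq_zero_iff.2 h)⟩
  have hemb := isOpenEmbedding_sphereChart U.value
  have himg : sphereChart U.value '' (Metric.ball 0 (flatRadius ρ) \ {0}) =
      sphericalDisk U.value ρ \ {U.value} := by
    rw [image_sdiff hemb.injective, ← sphericalDisk_eq_image ρ.2 hρ, image_singleton,
      sphereChart_zero]
  have hpre : Complex.exp ⁻¹' (Metric.ball 0 (flatRadius ρ) \ {0}) =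
      Complex.exp ⁻¹' Metric.ball 0 (flatRadius ρ) := by
    ext z
    simp [Complex.exp_ne_zero]
  let τ : (Metric.ball (0 : ℂ) (flatRadius ρ) \ {0} : Set ℂ) ≃ₜ
      (sphericalDisk U.value ρ \ {U.value} : Set (OnePoint ℂ)) :=
    (hemb.isEmbedding.homeomorphImage _).trans (Homeomorph.setCongr himg)
  have hcov : IsCoveringMap ((Metric.ball (0 : ℂ) (flatRadius ρ) \ {0}).restrictPreimage
      Complex.exp) :=
    (Complex.isCoveringMapOn_exp.mono fun z hz => hz.2).isCoveringMap_restrictPreimage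
  refine ⟨hmaps, ?_, ?_⟩
  · have := (hcov.homeomorph_comp τ).comp_homeomorph
      (Φ.symm.trans (Homeomorph.setCongr hpre.symm))
    convert this using 1
    funext x
    apply Subtype.ext
    change Ψ x = sphereChart U.value (Complex.exp (Φ.symm x : ℂ))
    rw [← hΦ, Φ.apply_symm_apply, hq]
  · have hne : (Complex.exp ⁻¹' Metric.ball 0 (flatRadius ρ)).Nonempty := by
      rw [exp_preimage_ball hr]
      exact ⟨((Real.log (flatRadius ρ) - 1 : ℝ) : ℂ), by simp⟩
    have := (convex_exp_preimage_ball hr).contractibleSpace hne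
    have : ContractibleSpace (U.nbhd ρ) := Φ.symm.contractibleSpace
    infer_instance

end

section

variable {M : Type*} [TopologicalSpace M] [T2Space M] [ChartedSpace ℂ M] {Ψ : M → OnePoint ℂ}
  {e : M} {U : Branch Ψ e} {ρ : Ioi (0 : ℝ)}

theorem isLocalHomeomorph_of_not_isCriticalPoint (hΨ : ∀ p, p ≠ e → IsMeromorphicAt Ψ p)
    (hcrit : ∀ x ∈ U.nbhd ρ, ¬ IsCriticalPoint Ψ x) :
    IsLocalHomeomorph fun x : U.nbhd ρ => Ψ x := by
  have : LocallyConnectedSpace M := ChartedSpace.locallyConnectedSpace ℂ M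
  have hopen : IsOpen (U.nbhd ρ) := U.isOpen_nbhd (fun p hp => (hΨ p hp).continuousAt) ρ
  have hon : IsLocalHomeomorphOn Ψ (U.nbhd ρ) := IsLocalHomeomorphOn.mk _ _ fun x hx =>
    (hΨ x (U.nbhd_subset ρ hx).1).exists_openPartialHomeomorph (hcrit x hx)
  rw [isLocalHomeomorph_iff_isLocalHomeomorphOn_univ]
  exact hon.comp hopen.isOpenEmbedding_subtypeVal.isLocalHomeomorph.isLocalHomeomorphOn
    fun x _ => x.2

/-- Paths in the punctured disk lift to a separating neighbourhood. -/
theorem IsTranscendental.exists_path_lift (hΨ : ∀ p, p ≠ e → IsMeromorphicAt Ψ p)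
    (hU : U.IsTranscendental)
    (hsep : ∀ V : Branch Ψ e, V.IsSingularity → V ≠ U → ∃ ρ₂, Disjoint (U.nbhd ρ) (V.nbhd ρ₂))
    (hρ : (ρ : ℝ) < Real.pi) {q : U.nbhd ρ → ℂ} (hq : U.IsCoordinate ρ q)
    (hql : IsLocalHomeomorph q) (γ : C(I, ℂ))
    (hγ : ∀ t, γ t ∈ Metric.ball 0 (flatRadius ρ) ∧ γ t ≠ 0) (x : U.nbhd ρ) (hx : q x = γ 0) :
    ∃ Γ : C(I, U.nbhd ρ), Γ 0 = x ∧ ∀ t, q (Γ t) = γ t := by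
  refine exists_path_lift_of_forall_tendsto hql γ hx fun t ht c hc hcq => ?_
  let γ' : ℝ → OnePoint ℂ := fun s => sphereChart U.value (γ (projIcc 0 1 zero_le_one s))
  have hγ' : Continuous γ' := (isOpenEmbedding_sphereChart U.value).continuous.comp
    (γ.continuous.comp continuous_projIcc)
  have hΨc : ∀ s ∈ Ico 0 t, γ' s = Ψ (c s) := fun s hs => by
    rw [← hq (c s), hcq s hs]
  -- Along the partial lift `Ψ` tends to the chart image of `γ` at time `t`, a point of the disk
  -- other than `a`.
  obtain ⟨y, hy, hlim⟩ := hU.exists_tendsto hΨ hsep ht.1 (c := fun s => (c s : M))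
    (continuous_subtype_val.comp_continuousOn hc) (fun s _ => (c s).2) (b := γ' t)
    ((sphereChart_mem_disk ρ.2 hρ).2 (by simpa using (hγ _).1))
    (fun h => (hγ (projIcc 0 1 zero_le_one t)).2
      ((isOpenEmbedding_sphereChart U.value).injective (h.trans (sphereChart_zero _).symm)))
    ((hγ'.continuousAt.tendsto.mono_left nhdsWithin_le_nhds).congr' (by
      filter_upwards [Ico_mem_nhdsLT ht.1] with s hs using hΨc s hs))
  exact ⟨⟨y, hy⟩, tendsto_subtype_rng.2 hlim⟩

/-- If the circles around `a` have compact preimages in a neighbourhood of a singularity at `e`,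
then `Ψ` extends continuously to `e`. -/
theorem tendsto_of_isCompact (hΨ : ∀ x, x ≠ e → ContinuousAt Ψ x)
    (hUe : U.AccumulatesAtEssential) (hρ : (ρ : ℝ) < Real.pi) {q : U.nbhd ρ → ℂ}
    (hq : U.IsCoordinate ρ q)
    (hcpt : ∀ ε, 0 < ε → ε < flatRadius ρ → IsCompact {x | ‖q x‖ = ε}) :
    Tendsto Ψ (𝓝[≠] e) (𝓝 U.value) := by
  have : LocallyConnectedSpace M := ChartedSpace.locallyConnectedSpace ℂ M
  intro N hN
  obtain ⟨ρ', h0, hlt, hpi, hsub⟩ := exists_sphericalDisk_subset hN ρ.2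
  have hle : (⟨ρ', h0⟩ : Ioi (0 : ℝ)) ≤ ρ := hlt.le
  have hC : IsCompact ((↑) '' {x : U.nbhd ρ | ‖q x‖ = flatRadius ρ'} : Set M) :=
    (hcpt _ (flatRadius_pos h0 hpi) (flatRadius_lt h0 hlt hρ)).image continuous_subtype_val
  have heC : e ∉ ((↑) '' {x : U.nbhd ρ | ‖q x‖ = flatRadius ρ'} : Set M) := by
    rintro ⟨x, -, hx⟩
    exact (U.nbhd_subset ρ x.2).1 hx
  obtain ⟨P, hP, heP, hPC, hPe⟩ :=
    exists_preconnected_punctured_nhds (hC.isClosed.isOpen_compl.mem_nhds heC)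
  -- A point of `P` adherent to `U_a(ρ')` but outside it would lie in `U_a(ρ)` over the circle
  -- bounding `D(a, ρ')`, in the compact set that `P` avoids.
  have hPU : P ⊆ U.nbhd ⟨ρ', h0⟩ := by
    refine hP.subset_of_closure_inter_subset (U.isOpen_nbhd hΨ _) ?_ ?_
    · obtain ⟨x, hx, hxU⟩ := mem_closure_iff_nhds.1 (hUe ⟨ρ', h0⟩) _ hPe
      rcases hx with rfl | hx
      · exact absurd rfl (U.nbhd_subset _ hxU).1
      · exact ⟨x, hx, hxU⟩
    · rintro x ⟨hx, hxP⟩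
      have hxe : x ≠ e := fun h => heP (h ▸ hxP)
      by_cases hxD : Ψ x ∈ sphericalDisk U.value ρ'
      · exact U.mem_nbhd_of_mem_closure hΨ hx ⟨hxe, hxD⟩
      exfalso
      have hxcl : Ψ x ∈ closure (sphericalDisk U.value ρ') := by
        refine mem_closure_iff_nhds.2 fun N' hN' => ?_
        obtain ⟨y, hy, hyU⟩ := mem_closure_iff_nhds.1 hx _ (hΨ x hxe hN')
        exact ⟨Ψ y, hy, (U.nbhd_subset _ hyU).2⟩
      have hxρ : x ∈ U.nbhd ρ := U.mem_nbhd_of_mem_closure hΨ (closure_mono (U.mono hle) hx)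
        ⟨hxe, closure_sphericalDisk_subset_disk h0 hlt hpi hxcl⟩
      obtain ⟨w, hw, hwx⟩ := closure_sphericalDisk_subset h0 hpi hxcl
      have hqw : q ⟨x, hxρ⟩ = w :=
        (isOpenEmbedding_sphereChart U.value).injective ((hq ⟨x, hxρ⟩).trans hwx.symm)
      have hnorm : ‖q ⟨x, hxρ⟩‖ = flatRadius ρ' := by
        refine le_antisymm ?_ (not_lt.1 fun h => hxD ?_)
        swap
        · exact (hq.norm_lt_iff (x := ⟨x, hxρ⟩) h0 hpi).1 h
        rw [hqw]
        simpa using hw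
      exact hPC hxP ⟨⟨x, hxρ⟩, hnorm, rfl⟩
  refine mem_nhdsWithin_iff_eventually.2 ?_
  filter_upwards [hPe] with x hx hxe
  exact hsub (U.nbhd_subset _ (hPU (hx.resolve_left hxe))).2

theorem IsSeparate.isLogarithmic (hΨ : IsTranscendentalMeromorphic Ψ e)
    (hU : U.IsTranscendental) (hUe : U.AccumulatesAtEssential) (hsep : U.IsSeparate) :
    U.IsLogarithmic := by
  obtain ⟨ρ₁, hsep⟩ := hsep
  -- Separation survives shrinking, and a radius below `π` keeps the antipode of `a` out of the
  -- disk.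
  let ρ : Ioi (0 : ℝ) := ⟨min ρ₁ (Real.pi / 2), lt_min ρ₁.2 (half_pos Real.pi_pos)⟩
  have hρ : (ρ : ℝ) < Real.pi := (min_le_right _ _).trans_lt (by linarith [Real.pi_pos])
  have hρρ₁ : ρ ≤ ρ₁ := min_le_left (ρ₁ : ℝ) _
  have hsep : ∀ V : Branch Ψ e, V.IsSingularity → V ≠ U →
      ∃ ρ₂, Disjoint (U.nbhd ρ) (V.nbhd ρ₂) := fun V hV hne =>
    (hsep V hV hne).imp fun ρ₂ h => h.mono_left (U.mono hρρ₁)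
  have hr := flatRadius_pos ρ.2 hρ
  have : PreconnectedSpace (U.nbhd ρ) :=
    isPreconnected_iff_preconnectedSpace.1 (U.isPreconnected_nbhd ρ)
  obtain ⟨q, hq⟩ := U.exists_isCoordinate hρ.le
  have hql : IsLocalHomeomorph q := hq.isLocalHomeomorph
    (isLocalHomeomorph_of_not_isCriticalPoint hΨ.1 fun x hx => hU.not_isCriticalPoint hΨ.1 hsep hx)
  obtain ⟨x₀, hx₀, hx₀a⟩ := hU.exists_ne ρ
  have hqx₀ : q ⟨x₀, hx₀⟩ ≠ 0 := by rwa [Ne, hq.eq_zero_iff]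
  have hz₀ : Complex.exp (Complex.log (q ⟨x₀, hx₀⟩)) ∈ Metric.ball 0 (flatRadius ρ) := by
    rw [Complex.exp_log hqx₀]
    exact hq.mem_ball hρ _
  obtain ⟨F, hF⟩ := exists_isExpLift hql (convex_exp_preimage_ball hr)
    (fun γ hγ x hx => hU.exists_path_lift hΨ.1 hsep hρ hq hql γ hγ x hx) hz₀
    (Complex.exp_log hqx₀).symm
  have hq0 := hU.coordinate_ne_zero hρ hq hql hF
  have hinj : InjOn F (Complex.exp ⁻¹' Metric.ball 0 (flatRadius ρ)) := by
    by_contra hinj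
    exact hΨ.2 ⟨U.value, tendsto_of_isCompact (fun x hx => (hΨ.1 x hx).continuousAt) hUe hρ hq
      fun ε hε hεr => hF.isCompact_setOf_norm_eq hql hr (hq.mem_ball hρ) hinj hε hεr⟩
  obtain ⟨Φ, hΦ⟩ := hF.exists_homeomorph hql Metric.isOpen_ball (hq.mem_ball hρ) ⟨_, hz₀⟩ hq0 hinj
  exact ⟨hU, ρ, hq.exists_isCoveringMap hρ hq0 Φ hΦ⟩

end

end Branch

/-! ### Logarithmic singularities are separate -/

theorem range_recip : range recip = {((0 : ℂ) : OnePoint ℂ)}ᶜ := by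
  ext x
  rw [mem_compl_singleton_iff]
  constructor
  · rintro ⟨w, rfl⟩ h
    by_cases hw : w = 0
    · rw [hw, recip_zero] at h
      exact OnePoint.infty_ne_coe _ h
    · rw [recip_of_ne_zero hw, OnePoint.coe_eq_coe] at h
      exact inv_ne_zero hw h
  · intro hx
    induction x using OnePoint.rec with
    | infty => exact ⟨0, recip_zero⟩
    | coe z =>
      have hz : z ≠ 0 := fun h => hx (by rw [h])
      exact ⟨z⁻¹, by rw [recip_of_ne_zero (inv_ne_zero hz), inv_inv]⟩

/-- The complement of a point of the sphere is a copy of `ℂ`. -/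
theorem exists_isOpenEmbedding_range_eq_compl (a : OnePoint ℂ) :
    ∃ S : ℂ → OnePoint ℂ, IsOpenEmbedding S ∧ range S = {a}ᶜ := by
  induction a using OnePoint.rec with
  | infty => exact ⟨_, OnePoint.isOpenEmbedding_coe, OnePoint.compl_infty.symm⟩
  | coe a =>
    let A : OnePoint ℂ ≃ₜ OnePoint ℂ := (Homeomorph.addLeft a).onePointCongr
    refine ⟨A ∘ recip, A.isOpenEmbedding.comp isOpenEmbedding_recip, ?_⟩
    have hA : A ((0 : ℂ) : OnePoint ℂ) = (a : OnePoint ℂ) := by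
      change ((a + 0 : ℂ) : OnePoint ℂ) = a
      rw [add_zero]
    rw [range_comp, range_recip, image_compl_eq A.bijective, image_singleton, hA]

theorem isPreconnected_punctured_sphericalDisk (a : OnePoint ℂ) {ρ : ℝ} (h0 : 0 < ρ)
    (hρ : ρ < Real.pi) : IsPreconnected (sphericalDisk a ρ \ {a}) := by
  have hemb := isOpenEmbedding_sphereChart a
  have : sphericalDisk a ρ \ {a} = (fun z => sphereChart a (Complex.exp z)) ''
      (Complex.exp ⁻¹' Metric.ball 0 (flatRadius ρ)) := by
    rw [sphericalDisk_eq_image h0 hρ]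
    ext x
    constructor
    · rintro ⟨⟨w, hw, rfl⟩, hwa⟩
      have hw0 : w ≠ 0 := fun h => hwa (by rw [h, sphereChart_zero]; rfl)
      exact ⟨Complex.log w, by rwa [mem_preimage, Complex.exp_log hw0],
        by simp only [Complex.exp_log hw0]⟩
    · rintro ⟨z, hz, rfl⟩
      refine ⟨⟨_, hz, rfl⟩, fun h => Complex.exp_ne_zero z (hemb.injective ?_)⟩
      exact (mem_singleton_iff.1 h).trans (sphereChart_zero a).symm
  rw [this]
  exact (convex_exp_preimage_ball (flatRadius_pos h0 hρ)).isPreconnected.image _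
    (hemb.continuous.comp Complex.continuous_exp).continuousOn

namespace Branch

variable {M : Type*} [TopologicalSpace M] {Ψ : M → OnePoint ℂ} {e : M} {U : Branch Ψ e}
  {ρ : Ioi (0 : ℝ)}

/-- Path lifting in the covering again produces a lift of `exp`, and connectedness comes from its
half-planes. -/
theorem isPreconnected_preimage_of_le_pi [T2Space M]
    (h : MapsTo Ψ (U.nbhd ρ) (sphericalDisk U.value ρ \ {U.value}))
    (hcov : IsCoveringMap h.restrict) (hρ : (ρ : ℝ) ≤ Real.pi) {ρ' : ℝ} (h0 : 0 < ρ')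
    (hρ' : ρ' < Real.pi) : IsPreconnected {x : U.nbhd ρ | Ψ x ∈ sphericalDisk U.value ρ'} := by
  have : PreconnectedSpace (U.nbhd ρ) :=
    isPreconnected_iff_preconnectedSpace.1 (U.isPreconnected_nbhd ρ)
  have hemb := isOpenEmbedding_sphereChart U.value
  have hD := isOpen_sphericalDisk U.value ρ.2
  have hBo : IsOpen (sphericalDisk U.value ρ \ {U.value}) := hD.sdiff isClosed_singleton
  obtain ⟨q, hq⟩ := U.exists_isCoordinate hρ
  have hq0 : ∀ x, q x ≠ 0 := fun x h0 => (h x.2).2 (hq.eq_zero_iff.1 h0)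
  have hql : IsLocalHomeomorph q := hq.isLocalHomeomorph
    (hBo.isOpenEmbedding_subtypeVal.isLocalHomeomorph.comp hcov.isLocalHomeomorph)
  -- At `ρ = π` this is the whole plane, whereas `flatRadius Real.pi` takes the default value `0` of
  -- the tangent at `π / 2`; hence a preimage and not a ball.
  let Ω : Set ℂ := sphereChart U.value ⁻¹' sphericalDisk U.value ρ
  have hΩo : IsOpen Ω := hD.preimage hemb.continuous
  have hqΩ : ∀ x, q x ∈ Ω := fun x => by
    rw [mem_preimage, hq x]
    exact (h x.2).1
  have hΩc : Convex ℝ (Complex.exp ⁻¹' Ω) := by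
    rcases hρ.lt_or_eq with hlt | heq
    · have : Ω = Metric.ball 0 (flatRadius ρ) := by
        ext w
        rw [mem_preimage, sphereChart_mem_disk ρ.2 hlt, mem_ball_zero_iff]
      rw [this]
      exact convex_exp_preimage_ball (flatRadius_pos ρ.2 hlt)
    · have : Ω = univ := by
        refine eq_univ_of_forall fun w => ?_
        rw [mem_preimage, heq, sphericalDisk_pi]
        exact mem_range_self w
      rw [this, preimage_univ]
      exact convex_univ
  obtain ⟨x₀, hx₀⟩ := U.nbhd_nonempty ρ
  have hz₀ : Complex.exp (Complex.log (q ⟨x₀, hx₀⟩)) ∈ Ω := by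
    rw [Complex.exp_log (hq0 _)]
    exact hqΩ _
  obtain ⟨F, hF⟩ := exists_isExpLift hql hΩc (fun γ hγ x hx => by
    let γ' : C(I, (sphericalDisk U.value ρ \ {U.value} : Set (OnePoint ℂ))) :=
      ⟨fun t => ⟨sphereChart U.value (γ t), (hγ t).1, fun h => (hγ t).2
        (hemb.injective ((mem_singleton_iff.1 h).trans (sphereChart_zero _).symm))⟩,
        (hemb.continuous.comp γ.continuous).subtype_mk _⟩
    obtain ⟨Γ, hΓ, hΓ0⟩ := hcov.exists_path_lifts γ' x (Subtype.ext (by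
      change sphereChart U.value (γ 0) = Ψ x
      rw [← hx, hq x]))
    refine ⟨Γ, hΓ0, fun t => hemb.injective ?_⟩
    rw [hq]
    exact congrArg Subtype.val (congrFun hΓ t)) hz₀ (Complex.exp_log (hq0 _)).symm
  have key := hF.isPreconnected_setOf_norm_lt hql hΩo hΩc hqΩ ⟨_, hz₀⟩ (flatRadius_pos h0 hρ')
  have hset : {x : U.nbhd ρ | Ψ x ∈ sphericalDisk U.value ρ'} =
      {x | q x ≠ 0 ∧ ‖q x‖ < flatRadius ρ'} := by
    ext x
    exact ⟨fun hx => ⟨hq0 x, (hq.norm_lt_iff h0 hρ').2 hx⟩,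
      fun hx => (hq.norm_lt_iff h0 hρ').1 hx.2⟩
  rwa [hset]

/-- For `ρ > π` the base is the sphere without `a`, a copy of `ℂ`. It is simply connected, so the
connected covering has one sheet and the preimage is a copy of the punctured disk. -/
theorem isPreconnected_preimage_of_pi_lt
    (h : MapsTo Ψ (U.nbhd ρ) (sphericalDisk U.value ρ \ {U.value}))
    (hcov : IsCoveringMap h.restrict) (hρ : Real.pi < (ρ : ℝ)) {ρ' : ℝ} (h0 : 0 < ρ')
    (hρ' : ρ' < Real.pi) : IsPreconnected {x : U.nbhd ρ | Ψ x ∈ sphericalDisk U.value ρ'} := by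
  have : PreconnectedSpace (U.nbhd ρ) :=
    isPreconnected_iff_preconnectedSpace.1 (U.isPreconnected_nbhd ρ)
  obtain ⟨S, hS, hSr⟩ := exists_isOpenEmbedding_range_eq_compl U.value
  have hSa : ∀ w, S w ≠ U.value := fun w => by
    have : S w ∈ ({U.value}ᶜ : Set (OnePoint ℂ)) := hSr ▸ mem_range_self w
    exact this
  let f : C(ℂ, (sphericalDisk U.value ρ \ {U.value} : Set (OnePoint ℂ))) :=
    ⟨fun w => ⟨S w, by rw [sphericalDisk_of_pi_lt _ hρ]; exact mem_univ _, hSa w⟩,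
      hS.continuous.subtype_mk _⟩
  have hg : ∀ x : U.nbhd ρ, ∃ w, S w = Ψ x := fun x => by
    have : Ψ x ∈ range S := hSr ▸ (h x.2).2
    exact this
  choose g hg using hg
  have hΨc : Continuous fun x : U.nbhd ρ => Ψ x := continuous_subtype_val.comp hcov.continuous
  have hgc : Continuous g := by
    rw [hS.isInducing.continuous_iff]
    exact hΨc.congr fun x => (hg x).symm
  obtain ⟨x₀, hx₀⟩ := U.nbhd_nonempty ρ
  obtain ⟨s, ⟨hs0, hs⟩, -⟩ := hcov.existsUnique_continuousMap_lifts f (g ⟨x₀, hx₀⟩) ⟨x₀, hx₀⟩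
    (Subtype.ext (hg _).symm)
  have hsg : s ∘ g = id := hcov.eq_of_comp_eq (s.continuous.comp hgc) continuous_id
    (by
      funext x
      refine (congrFun hs (g x)).trans (Subtype.ext (hg x))) ⟨x₀, hx₀⟩ hs0
  have hΨs : ∀ w, Ψ (s w) = S w := fun w => congrArg Subtype.val (congrFun hs w)
  have hset : {x : U.nbhd ρ | Ψ x ∈ sphericalDisk U.value ρ'} =
      s '' (S ⁻¹' (sphericalDisk U.value ρ' \ {U.value})) := by
    ext x
    constructor
    · intro hx
      refine ⟨g x, ⟨?_, ?_⟩, congrFun hsg x⟩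
      · rw [hg]; exact hx
      · rw [hg]; exact (h x.2).2
    · rintro ⟨w, hw, rfl⟩
      rw [mem_ofPred_eq, hΨs]
      exact hw.1
  rw [hset]
  refine IsPreconnected.image ?_ _ s.continuous.continuousOn
  refine (isPreconnected_punctured_sphericalDisk U.value h0 hρ').preimage_of_isOpenMap hS.injective
    hS.isOpenMap ?_
  rw [hSr]
  exact fun x hx => hx.2

/-- In a covering of the punctured disk, the preimages of smaller punctured disks are connected. -/
theorem isPreconnected_preimage [T2Space M]
    (h : MapsTo Ψ (U.nbhd ρ) (sphericalDisk U.value ρ \ {U.value}))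
    (hcov : IsCoveringMap h.restrict) {ρ' : ℝ} (h0 : 0 < ρ') (hρ' : ρ' < Real.pi) :
    IsPreconnected {x : U.nbhd ρ | Ψ x ∈ sphericalDisk U.value ρ'} := by
  rcases le_or_gt (ρ : ℝ) Real.pi with hρ | hρ
  · exact isPreconnected_preimage_of_le_pi h hcov hρ h0 hρ'
  · exact isPreconnected_preimage_of_pi_lt h hcov hρ h0 hρ'

/-- There is only one branch over `a` that meets all neighbourhoods of a logarithmic
singularity. -/
theorem eq_of_isCoveringMap [T2Space M] {V : Branch Ψ e}
    (h : MapsTo Ψ (U.nbhd ρ) (sphericalDisk U.value ρ \ {U.value}))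
    (hcov : IsCoveringMap h.restrict) (hv : V.value = U.value)
    (hmeet : ∀ ρ₂, (V.nbhd ρ₂ ∩ U.nbhd ρ).Nonempty) : V = U := by
  refine eq_of_forall_meet hv fun ρ₂ => ?_
  obtain ⟨ρ', h0, hlt⟩ := exists_between (lt_min (lt_min ρ₂.2 ρ.2) Real.pi_pos)
  have hρ₂ : (⟨ρ', h0⟩ : Ioi (0 : ℝ)) ≤ ρ₂ :=
    (hlt.trans_le ((min_le_left _ _).trans (min_le_left _ _))).le
  have hρ : (⟨ρ', h0⟩ : Ioi (0 : ℝ)) ≤ ρ :=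
    (hlt.trans_le ((min_le_left _ _).trans (min_le_right _ _))).le
  have hpi : ρ' < Real.pi := hlt.trans_le (min_le_right _ _)
  refine ⟨⟨ρ', h0⟩, hρ₂, ?_⟩
  have hVU : V.nbhd ⟨ρ', h0⟩ ⊆ U.nbhd ρ :=
    U.nbhd_subset_nbhd V (by rw [hv]; exact sphericalDisk_mono _ hρ) (hmeet _)
  have hsub : ((↑) '' {x : U.nbhd ρ | Ψ x ∈ sphericalDisk U.value ρ'} : Set M) ⊆
      U.nbhd ⟨ρ', h0⟩ := by
    refine U.subset_nbhd ((isPreconnected_preimage h hcov h0 hpi).image _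
      continuous_subtype_val.continuousOn) ?_ ?_
    · rintro _ ⟨x, hx, rfl⟩
      exact ⟨(U.nbhd_subset ρ x.2).1, hx⟩
    · obtain ⟨y, hy⟩ := U.nbhd_nonempty ⟨ρ', h0⟩
      -- The connected part of `U_a(ρ)` over the smaller disk contains `U_a(ρ')`, hence equals it;
      -- `V` enters this part.
      exact ⟨y, ⟨⟨y, U.mono hρ hy⟩, (U.nbhd_subset _ hy).2, rfl⟩, hy⟩
  obtain ⟨y, hy⟩ := V.nbhd_nonempty ⟨ρ', h0⟩
  have hyD := (V.nbhd_subset _ hy).2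
  rw [hv] at hyD
  exact ⟨y, hy, hsub ⟨⟨y, hVU hy⟩, hyD, rfl⟩⟩

/-- The branches over points of the punctured disk that meet all neighbourhoods of a logarithmic
singularity are branches at ordinary points. -/
theorem not_isSingularity_of_isCoveringMap [ChartedSpace ℂ M] {V : Branch Ψ e}
    (hopen : IsOpen (U.nbhd ρ))
    (h : MapsTo Ψ (U.nbhd ρ) (sphericalDisk U.value ρ \ {U.value}))
    (hcov : IsCoveringMap h.restrict) (hbD : V.value ∈ sphericalDisk U.value ρ)
    (hba : V.value ≠ U.value) (hmeet : ∀ ρ₂, (V.nbhd ρ₂ ∩ U.nbhd ρ).Nonempty) :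
    ¬ V.IsSingularity := by
  have hBo : IsOpen (sphericalDisk U.value ρ \ {U.value}) :=
    (isOpen_sphericalDisk U.value ρ.2).sdiff isClosed_singleton
  have hemb := isOpenEmbedding_sphereChart V.value
  obtain ⟨r, h0, -, hpi, hsub⟩ :=
    exists_sphericalDisk_subset (hBo.mem_nhds ⟨hbD, hba⟩) one_pos
  let ρ₀ : Ioi (0 : ℝ) := ⟨r, h0⟩
  have hVU : V.nbhd ρ₀ ⊆ U.nbhd ρ :=
    U.nbhd_subset_nbhd V (fun x hx => (hsub hx).1) (hmeet _)
  have hpos := flatRadius_pos h0 hpi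
  let B : Set ℂ := Metric.ball 0 (flatRadius r)
  have hB0 : (0 : ℂ) ∈ B := Metric.mem_ball_self hpos
  have : ContractibleSpace B := (convex_ball _ _).contractibleSpace ⟨0, hB0⟩
  have : LocallyPathConnectedSpace B := Metric.isOpen_ball.locallyPathConnectedSpace
  have : PreconnectedSpace (V.nbhd ρ₀) :=
    isPreconnected_iff_preconnectedSpace.1 (V.isPreconnected_nbhd ρ₀)
  let f : C(B, (sphericalDisk U.value ρ \ {U.value} : Set (OnePoint ℂ))) :=
    ⟨fun w => ⟨sphereChart V.value w, hsub ((sphereChart_mem_disk h0 hpi).2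
      (mem_ball_zero_iff.1 w.2))⟩, (hemb.continuous.comp continuous_subtype_val).subtype_mk _⟩
  obtain ⟨κ, hκ⟩ := V.exists_isCoordinate (ρ := ρ₀) hpi.le
  let ι : V.nbhd ρ₀ → U.nbhd ρ := inclusion hVU
  have hιc : Continuous ι := continuous_inclusion hVU
  have hκc : Continuous κ := by
    rw [hemb.isInducing.continuous_iff]
    exact ((continuous_subtype_val.comp hcov.continuous).comp hιc).congr fun x => (hκ x).symm
  let κ' : V.nbhd ρ₀ → B := fun x => ⟨κ x, hκ.mem_ball hpi x⟩
  obtain ⟨x₀, hx₀⟩ := V.nbhd_nonempty ρ₀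
  obtain ⟨s, ⟨hs0, hs⟩, -⟩ := hcov.existsUnique_continuousMap_lifts f (κ' ⟨x₀, hx₀⟩)
    (ι ⟨x₀, hx₀⟩) (Subtype.ext (hκ ⟨x₀, hx₀⟩).symm)
  have hΨs : ∀ w, Ψ (s w) = sphereChart V.value w := fun w =>
    congrArg Subtype.val (congrFun hs w)
  -- By uniqueness of lifts the section over the disk around `b` retraces all of `V_b(ρ₀)`; its
  -- centre `z` will lie in every neighbourhood of `V`.
  have hsκ : s ∘ κ' = ι := hcov.eq_of_comp_eq (s.continuous.comp (hκc.subtype_mk _)) hιc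
    (by
      funext x
      exact (congrFun hs (κ' x)).trans (Subtype.ext (hκ x))) ⟨x₀, hx₀⟩ hs0
  let z : U.nbhd ρ := s ⟨0, hB0⟩
  have hzV : ∀ ρ₂, (z : M) ∈ V.nbhd ρ₂ := by
    intro ρ₂
    have hle : min ρ₀ ρ₂ ≤ ρ₀ := min_le_left _ _
    have hlepi : ((min ρ₀ ρ₂ : Ioi (0 : ℝ)) : ℝ) < Real.pi := lt_of_le_of_lt hle hpi
    refine V.mono (min_le_right ρ₀ ρ₂) ?_
    let B' : Set ℂ := Metric.ball 0 (flatRadius (min ρ₀ ρ₂ : Ioi (0 : ℝ)))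
    have hpre : IsPreconnected ((↑) ⁻¹' B' : Set B) := by
      refine IsPreconnected.preimage_of_isOpenMap ((convex_ball _ _).isPreconnected)
        Subtype.val_injective Metric.isOpen_ball.isOpenMap_subtype_val ?_
      rw [Subtype.range_coe]
      refine Metric.ball_subset_ball ?_
      rcases (show ((min ρ₀ ρ₂ : Ioi (0 : ℝ)) : ℝ) ≤ r from hle).eq_or_lt with heq | hlt
      · rw [heq]
      · exact (flatRadius_lt (min ρ₀ ρ₂).2 hlt hpi).le
    have hpos' := flatRadius_pos (min ρ₀ ρ₂).2 hlepi
    refine V.subset_nbhd (A := (fun w : B => (s w : M)) '' (Subtype.val ⁻¹' B'))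
      (hpre.image _ (continuous_subtype_val.comp s.continuous).continuousOn) ?_ ?_
      ⟨⟨0, hB0⟩, Metric.mem_ball_self hpos', rfl⟩
    · rintro _ ⟨w, hw, rfl⟩
      refine ⟨(U.nbhd_subset ρ (s w).2).1, ?_⟩
      rw [hΨs, sphereChart_mem_disk (min ρ₀ ρ₂).2 hlepi]
      exact mem_ball_zero_iff.1 hw
    · obtain ⟨x, hx⟩ := V.nbhd_nonempty (min ρ₀ ρ₂)
      have hx' : x ∈ V.nbhd ρ₀ := V.mono hle hx
      refine ⟨x, ⟨κ' ⟨x, hx'⟩, ?_, congrArg Subtype.val (congrFun hsκ ⟨x, hx'⟩)⟩, hx⟩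
      exact mem_ball_zero_iff.2
        ((hκ.norm_lt_iff (x := ⟨x, hx'⟩) (min ρ₀ ρ₂).2 hlepi).2 (V.nbhd_subset _ hx).2)
  have hzI : (z : M) ∈ ⋂ ρ, V.nbhd ρ := mem_iInter.2 hzV
  -- An algebraic `V` would have `z` as critical point, but `Ψ` is injective near `z`; a
  -- transcendental one has empty intersection.
  rintro (⟨z₁, hz₁, hcrit⟩ | htr)
  · rw [hz₁, mem_singleton_iff] at hzI
    rw [← hzI] at hcrit
    obtain ⟨N, hN, hinj⟩ := 
      isLocallyInjective_iff_nhds.1 hcov.isLocalHomeomorph.isLocallyInjective z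
    refine not_isCriticalPoint_of_injOn (N := (↑) '' N)
      (hopen.isOpenEmbedding_subtypeVal.image_mem_nhds.2 hN) ?_ hcrit
    rintro _ ⟨x, hx, rfl⟩ _ ⟨y, hy, rfl⟩ hxy
    exact congrArg Subtype.val (hinj hx hy (Subtype.ext hxy))
  · rw [show (⋂ ρ, V.nbhd ρ) = ∅ from htr] at hzI
    exact hzI

theorem IsLogarithmic.isSeparate [T2Space M] [ChartedSpace ℂ M]
    (hΨ : ∀ p, p ≠ e → IsMeromorphicAt Ψ p) (hU : U.IsLogarithmic) : U.IsSeparate := by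
  have : LocallyConnectedSpace M := ChartedSpace.locallyConnectedSpace ℂ M
  obtain ⟨-, ρ, h, hcov, -⟩ := hU
  -- With `ρ₁` strictly below `ρ` and `π`, the closed disk of radius `ρ₁` stays inside `D(a, ρ)`, so
  -- values outside the latter have disks missing the former.
  obtain ⟨ρ₁, h0, hlt⟩ := exists_between (lt_min ρ.2 Real.pi_pos)
  have hρ : ρ₁ < ρ := hlt.trans_le (min_le_left _ _)
  have hpi : ρ₁ < Real.pi := hlt.trans_le (min_le_right _ _)
  refine ⟨⟨ρ₁, h0⟩, fun V hV hne => ?_⟩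
  by_contra! hcon
  have hmeet₁ : ∀ ρ₂, (V.nbhd ρ₂ ∩ U.nbhd ⟨ρ₁, h0⟩).Nonempty := fun ρ₂ => by
    rw [inter_comm]
    exact not_disjoint_iff_nonempty_inter.1 (hcon ρ₂)
  have hmeet : ∀ ρ₂, (V.nbhd ρ₂ ∩ U.nbhd ρ).Nonempty := fun ρ₂ =>
    (hmeet₁ ρ₂).mono (inter_subset_inter_right _ (U.mono hρ.le))
  by_cases hba : V.value = U.value
  · exact hne (eq_of_isCoveringMap h hcov hba hmeet)
  by_cases hbD : V.value ∈ sphericalDisk U.value ρ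
  · exact not_isSingularity_of_isCoveringMap
      (U.isOpen_nbhd (fun p hp => (hΨ p hp).continuousAt) ρ) h hcov hbD hba hmeet hV
  · have hcl : V.value ∉ closure (sphericalDisk U.value ρ₁) := fun hmem =>
      hbD (closure_sphericalDisk_subset_disk h0 hρ hpi hmem)
    obtain ⟨ρ₂, hρ₂, -, -, hsub⟩ :=
      exists_sphericalDisk_subset (isClosed_closure.isOpen_compl.mem_nhds hcl) one_pos
    obtain ⟨x, hxV, hxU⟩ := hmeet₁ ⟨ρ₂, hρ₂⟩
    exact hsub (V.nbhd_subset _ hxV).2 (subset_closure (U.nbhd_subset _ hxU).2)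

end Branch

end InverseSingularity

end

theorem mainTheorem12 {M : Type*} [TopologicalSpace M] [T2Space M] [ConnectedSpace M]
    [ChartedSpace ℂ M] [IsManifold 𝓘(ℂ) ω M]
    (Ψ : M → OnePoint ℂ) (e : M)
    (hΨ : InverseSingularity.IsTranscendentalMeromorphic Ψ e)
    (U : InverseSingularity.Branch Ψ e) (hU : U.IsTranscendental)
    (hUe : U.AccumulatesAtEssential) :
    ¬ U.IsLogarithmic ↔ ¬ U.IsSeparate :=
  not_congr ⟨fun h => h.isSeparate hΨ.1, fun h => h.isLogarithmic hΨ hU hUe⟩
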